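/- Graphs are finite and connected; loops and multiple edges are allowed. For a graph $G$ let $\beta(G)=|E(G)|-|V(G)|+1$ be its Betti number, and let $\gamma_M(G)$, its maximum genus, be the largest $k$ such that $G$ has a cellular embedding in the orientable closed surface of genus $k$; $G$ is upper-embeddable if $\gamma_M(G)=\lfloor\beta(G)/2\rfloor$. Let $G$ be cellularly embedded in a closed connected surface $\Sigma$, orientable or not, and let $G^*$ be the dual graph, embedded in $\Sigma$ with one vertex in each face of $G$ and one edge $e^*$ crossing each edge $e$ of $G$. Let $C^*$ be a cycle of $G^*$ (possibly a loop or a pair of parallel edges) that is surface separating, i.e. $\Sigma-C^*$ is disconnected. Let $G_L(C^*)$ and $G_R(C^*)$ be the left and the right subgraph of $G$, i.e. the subgraphs formed by the vertices and edges of $G$ that lie in the one and in the other component of $\Sigma-C^*$. If $G_L(C^*)$ and $G_R(C^*)$ are both upper-embeddable, then $$\gamma_M(G)\ \ge\ \left\lfloor \frac{\beta(G)}{2}\right\rfloor-1 .$$ If, in addition, $\beta(G_L(C^*))\equiv\beta(G_R(C^*))\equiv 0 \pmod 2$, then $G$ is upper-embeddable. -/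

import Mathlib

universe u v w

namespace Graph

/-- A multigraph (loops and parallel edges allowed) is connected if it has a vertex and any two of
its vertices are joined by a walk. -/
def IsConnected {α : Type u} {β : Type v} (G : Graph α β) : Prop :=
  G.vertexSet.Nonempty ∧
    ∀ x ∈ G.vertexSet, ∀ y ∈ G.vertexSet, Relation.ReflTransGen G.Adj x y

/-- The Betti number `|E| - |V| + 1` of a finite connected multigraph. -/
noncomputable def betti {α : Type u} {β : Type v} (G : Graph α β) : ℤ :=
  (G.edgeSet.ncard : ℤ) - (G.vertexSet.ncard : ℤ) + 1

/-- A cycle `v₀ e₀ v₁ e₁ ⋯ vₙ eₙ v₀` with `n + 1 ≥ 1` distinct vertices and as many distinct edges.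
A loop is a cycle of length one, and two parallel edges form a cycle of length two. Addition in
`Fin (n + 1)` is cyclic. -/
structure Cycle {α : Type u} {β : Type v} (G : Graph α β) where
  n : ℕ
  vtx : Fin (n + 1) → α
  edge : Fin (n + 1) → β
  vtx_injective : Function.Injective vtx
  edge_injective : Function.Injective edge
  isLink : ∀ i, G.IsLink (edge i) (vtx i) (vtx (i + 1))

/-- The set of edges of a cycle. -/
def Cycle.edges {α : Type u} {β : Type v} {G : Graph α β} (C : G.Cycle) : Set β :=
  Set.range C.edge

/-- A cellular embedding, up to homeomorphism, of a finite connected multigraph `G` in a closed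
surface, orientable or not, given by its flags.

A flag is a triangle of the barycentric subdivision of the embedding: its corners are a vertex `v`
of `G`, the midpoint of an edge `e`, and the centre of a face `f`; the two ends and the two
sides of an edge give four flags for each edge. The maps `τ₀`, `τ₁`, `τ₂` send a flag to the
neighbouring one across the side opposite to `v`, `e`, `f` respectively, so that `τ₀` moves to the
other end of the edge, `τ₁` to the other edge at the same corner of the face, and `τ₂` to
the other side of the edge. The surface is the union of the triangles glued by these maps. It is
connected if `G` is connected; the graph with a single vertex and no edge, which has
no flags, is understood to be embedded in the sphere. -/
structure CellularEmbedding {α : Type u} {β : Type v} (G : Graph α β) (Φ : Type w) where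
  τ₀ : Φ → Φ
  τ₁ : Φ → Φ
  τ₂ : Φ → Φ
  /-- The vertex of a flag. -/
  vert : Φ → α
  /-- The edge of a flag. -/
  edge : Φ → β
  τ₀_τ₀ : ∀ x, τ₀ (τ₀ x) = x
  τ₁_τ₁ : ∀ x, τ₁ (τ₁ x) = x
  τ₂_τ₂ : ∀ x, τ₂ (τ₂ x) = x
  τ₀_ne : ∀ x, τ₀ x ≠ x
  τ₁_ne : ∀ x, τ₁ x ≠ x
  τ₂_ne : ∀ x, τ₂ x ≠ x
  τ₀_τ₂ : ∀ x, τ₀ (τ₂ x) = τ₂ (τ₀ x)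
  τ₀_τ₂_ne : ∀ x, τ₀ (τ₂ x) ≠ x
  /-- Every flag belongs to an edge of `G`, whose ends are the vertices of `x` and of `τ₀ x`. -/
  isLink : ∀ x, G.IsLink (edge x) (vert x) (vert (τ₀ x))
  /-- Every edge of `G` has a flag. -/
  exists_edge_eq : ∀ e ∈ G.edgeSet, ∃ x, edge x = e
  /-- The flags of an edge form one orbit under `τ₀` and `τ₂`. -/
  edge_eq_iff : ∀ x y, edge x = edge y ↔
    y = x ∨ y = τ₀ x ∨ y = τ₂ x ∨ y = τ₀ (τ₂ x)
  /-- The flags of a vertex form one orbit under `τ₁` and `τ₂`: a disc around the vertex. -/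
  vert_eq_iff : ∀ x y, vert x = vert y ↔
    Relation.EqvGen (fun a b => b = τ₁ a ∨ b = τ₂ a) x y

namespace CellularEmbedding

/-- The faces: the orbits of flags under `τ₀` and `τ₁`, and for a vertex without edges (in a
connected graph, the only vertex) the face surrounding it, which has no flags. -/
def Face {α : Type u} {β : Type v} {G : Graph α β} {Φ : Type w}
    (M : G.CellularEmbedding Φ) : Type (max u w) :=
  Quot (fun x y : Φ => y = M.τ₀ x ∨ y = M.τ₁ x) ⊕
    {a : α // a ∈ G.vertexSet ∧ ∀ e, ¬ G.Inc e a}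

/-- The face of a flag. -/
def face {α : Type u} {β : Type v} {G : Graph α β} {Φ : Type w}
    (M : G.CellularEmbedding Φ) (x : Φ) : M.Face :=
  Sum.inl (Quot.mk _ x)

theorem face_τ₀ {α : Type u} {β : Type v} {G : Graph α β} {Φ : Type w}
    (M : G.CellularEmbedding Φ) (x : Φ) : M.face (M.τ₀ x) = M.face x :=
  congrArg Sum.inl (Quot.sound (Or.inl (M.τ₀_τ₀ x).symm))

theorem edge_τ₂ {α : Type u} {β : Type v} {G : Graph α β} {Φ : Type w}
    (M : G.CellularEmbedding Φ) (x : Φ) : M.edge (M.τ₂ x) = M.edge x :=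
  ((M.edge_eq_iff x (M.τ₂ x)).2 (Or.inr (Or.inr (Or.inl rfl)))).symm

/-- The Euler characteristic `|V| - |E| + |F|`. -/
noncomputable def eulerChar {α : Type u} {β : Type v} {G : Graph α β} {Φ : Type w}
    (M : G.CellularEmbedding Φ) : ℤ :=
  (G.vertexSet.ncard : ℤ) - (G.edgeSet.ncard : ℤ) + (Nat.card M.Face : ℤ)

/-- The surface is orientable: the triangles can be oriented so that any two triangles
glued along a side are coherently oriented, i.e. are of opposite sign. -/
def IsOrientable {α : Type u} {β : Type v} {G : Graph α β} {Φ : Type w}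
    (M : G.CellularEmbedding Φ) : Prop :=
  ∃ c : Φ → Bool, ∀ x, c (M.τ₀ x) ≠ c x ∧ c (M.τ₁ x) ≠ c x ∧ c (M.τ₂ x) ≠ c x

/-- The dual graph `G*`: its vertices are the faces of the embedding, and each edge `e` of `G`
gives one edge of `G*`, which joins the faces on the two sides of `e`. -/
def dual {α : Type u} {β : Type v} {G : Graph α β} {Φ : Type w}
    (M : G.CellularEmbedding Φ) : Graph M.Face β where
  vertexSet := Set.univ
  IsLink e f g := ∃ x, M.edge x = e ∧ M.face x = f ∧ M.face (M.τ₂ x) = g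
  isLink_symm := by
    intro e _
    refine ⟨?_⟩
    rintro f g ⟨x, he, hf, hg⟩
    exact ⟨M.τ₂ x, by rw [M.edge_τ₂, he], hg, by rw [M.τ₂_τ₂, hf]⟩
  eq_or_eq_of_isLink_of_isLink := by
    rintro e f g f' g' ⟨x, hx, rfl, rfl⟩ ⟨y, hy, rfl, rfl⟩
    rcases (M.edge_eq_iff x y).1 (hx.trans hy.symm) with rfl | rfl | rfl | rfl
    · exact Or.inl rfl
    · exact Or.inl (M.face_τ₀ x).symm
    · exact Or.inr (by rw [M.τ₂_τ₂])
    · exact Or.inr (by rw [← M.τ₀_τ₂, M.τ₂_τ₂, M.face_τ₀])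
  left_mem_of_isLink := fun _ _ _ _ => Set.mem_univ _

/-- The components of `Σ - C*` for a cycle `C*` of the dual graph. A dual edge `e*` runs from one
face centre to the other through the midpoint of `e`, along the sides that separate a flag `x` of
`e` from `τ₀ x`. Hence two neighbouring triangles are connected in `Σ - C*` unless they are `x` and
`τ₀ x` with the edge of `x` in `C*`. -/
def Region {α : Type u} {β : Type v} {G : Graph α β} {Φ : Type w}
    (M : G.CellularEmbedding Φ) (C : M.dual.Cycle) : Type w :=
  Quot (fun x y : Φ => y = M.τ₁ x ∨ y = M.τ₂ x ∨ (M.edge x ∉ C.edges ∧ y = M.τ₀ x))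

/-- The cycle `C*` is surface separating: `Σ - C*` is disconnected. -/
def SurfaceSeparating {α : Type u} {β : Type v} {G : Graph α β} {Φ : Type w}
    (M : G.CellularEmbedding Φ) (C : M.dual.Cycle) : Prop :=
  ∃ R S : M.Region C, R ≠ S

/-- The subgraph of `G` that lies in the component `R` of `Σ - C*`: its vertices are the vertices
of `G` in `R`, its edges are the edges of `G` that do not cross `C*` and have their ends in `R`. -/
def sideGraph {α : Type u} {β : Type v} {G : Graph α β} {Φ : Type w}
    (M : G.CellularEmbedding Φ) (C : M.dual.Cycle) (R : M.Region C) : Graph α β :=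
  (G.deleteEdges C.edges).induce {a | ∃ x : Φ, M.vert x = a ∧ Quot.mk _ x = R}

end CellularEmbedding

/-- `G` has a cellular embedding in the orientable surface of genus `k`, that is, the orientable
closed surface of Euler characteristic `2 - 2k`. For a finite graph there are finitely many flags,
so flag types in the lowest universe suffice. -/
def EmbedsInOrientableGenus {α : Type u} {β : Type v} (G : Graph α β) (k : ℕ) : Prop :=
  ∃ (Φ : Type) (M : G.CellularEmbedding Φ), M.IsOrientable ∧ M.eulerChar = 2 - 2 * (k : ℤ)

/-- The maximum genus of a finite connected multigraph. -/
noncomputable def maxGenus {α : Type u} {β : Type v} (G : Graph α β) : ℕ :=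
  sSup {k : ℕ | G.EmbedsInOrientableGenus k}

/-- `G` is upper-embeddable: its maximum genus is `⌊β(G) / 2⌋`. -/
def UpperEmbeddable {α : Type u} {β : Type v} (G : Graph α β) : Prop :=
  (G.maxGenus : ℤ) = G.betti / 2

end Graph

/-! The surface enters only once. A separating dual cycle `C` leaves exactly two regions, and every
edge of `C` has one end of `G` in each (`separates_of_edge_mem`, `region_eq_or_eq`). So the edge set
D of `C` is the cut between the connected graphs G_L and G_R, and β(G) = β(G_L) + β(G_R) + |D| - 1.
The rest concerns rotation systems of multigraphs: by Euler's formula an orientable embedding with F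
faces has genus (β + 1 - F)/2, so a rotation system with few faces is wanted.

Inserting an edge into a rotation system splits a face if both chosen corners lie in the same face,
and merges two faces otherwise. Two edges with a common vertex can always be inserted without
raising the number of faces (`FaceBound.insert_insert`): if the first one splits a face, the common
vertex has corners in both parts, and one of them lets the second edge merge two faces.

The converse is `IsRotation.exists_reduces`: from a rotation system of a connected graph with F
faces, edges can be removed singly or in adjacent pairs until a spanning tree remains, with exactly
F - 1 single removals. For an upper-embeddable graph F - 1 is the parity of β, so each side is a
spanning tree plus adjacent pairs plus at most one further edge (`UpperEmbeddable.exists_tree`).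

Putting these edges back costs the same number of faces whatever other edges are present. It
therefore suffices to treat the two spanning trees together with D. That graph has Betti number |D|
- 1 and a rotation system with at most 1 + (|D| - 1) mod 2 faces (`IsTree.faceBound_union`). In
total F ≤ 1 + (|D| - 1) mod 2 + β(G_L) mod 2 + β(G_R) mod 2, so the genus is at least the sum of the
floors of the halves of the three summands of β(G). This falls short of ⌊β(G)/2⌋ by at most 1, and
by nothing if two of the summands are even.

Each vertex carries an auxiliary half-edge, so that it always has a corner for an insertion and an
isolated vertex has a face of its own. -/

set_option linter.unusedSectionVars false

/-! ### Orbits of a permutation multiplied by a transposition -/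

namespace Equiv.Perm

variable {X : Type*}

/-- The number of orbits of a permutation, fixed points included. -/
noncomputable def orbitCount (π : Perm X) : ℕ := Nat.card (Quotient (SameCycle.setoid π))

theorem SameCycle.mem_of_forall_mem [Finite X] {π : Perm X} {P : Set X}
    (hP : ∀ x ∈ P, π x ∈ P) {x y : X} (h : SameCycle π x y) (hx : x ∈ P) : y ∈ P := by
  obtain ⟨n, rfl⟩ := h.exists_nat_pow_eq
  induction n with
  | zero => simpa using hx
  | succ n ih =>
    rw [pow_succ']
    exact hP _ (ih ⟨n, by simp⟩)

theorem SameCycle.exists_minimal_pow [Finite X] {π : Perm X} {a b : X} (h : SameCycle π a b) :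
    ∃ k, 0 < k ∧ (π ^ k) a = b ∧ ∀ i, 0 < i → i < k → (π ^ i) a ≠ b := by
  classical
  have hex : ∃ k, 0 < k ∧ (π ^ k) a = b := by
    obtain ⟨i, hi, _, h⟩ := h.exists_pow_eq''
    exact ⟨i, hi, h⟩
  refine ⟨Nat.find hex, (Nat.find_spec hex).1, (Nat.find_spec hex).2, fun i hi hk hb => ?_⟩
  exact Nat.find_min hex hk ⟨hi, hb⟩

variable [DecidableEq X]

/-- The new orbit of `a` follows `π` until `π` would return to `a`; there the transposition diverts
it to `b`. -/
theorem sameCycle_swap_mul_self_of_not_sameCycle [Finite X] {π : Perm X} {a b : X}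
    (h : ¬ SameCycle π a b) : SameCycle (swap a b * π) a b := by
  obtain ⟨n, hn, hna, hmin⟩ := (SameCycle.refl π a).exists_minimal_pow
  have key : ∀ i, i < n → ((swap a b * π) ^ i) a = (π ^ i) a := by
    intro i hi
    induction i with
    | zero => simp
    | succ i ih =>
      rw [pow_succ', mul_apply, ih (by omega), mul_apply, ← mul_apply π, ← pow_succ']
      refine swap_apply_of_ne_of_ne (hmin _ (by omega) hi) fun hb => h ⟨(i + 1 : ℕ), ?_⟩
      rw [zpow_natCast]
      exact hb
  refine ⟨n, ?_⟩
  obtain ⟨m, rfl⟩ : ∃ m, n = m + 1 := ⟨n - 1, by omega⟩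
  rw [zpow_natCast, pow_succ', mul_apply, key m (by omega), mul_apply, ← mul_apply π,
    ← pow_succ', hna, swap_apply_left]

theorem sameCycle_swap_mul_iff [Finite X] {π : Perm X} {a b : X} (h : ¬ SameCycle π a b)
    {x y : X} :
    SameCycle (swap a b * π) x y ↔ SameCycle π x y ∨
      ((SameCycle π a x ∨ SameCycle π b x) ∧ (SameCycle π a y ∨ SameCycle π b y)) := by
  have hab := sameCycle_swap_mul_self_of_not_sameCycle h
  have step : ∀ x, SameCycle (swap a b * π) x (π x) := by
    intro x
    have h1 : SameCycle (swap a b * π) x ((swap a b * π) x) :=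
      sameCycle_apply_right.2 (SameCycle.refl _ _)
    rw [mul_apply] at h1
    by_cases ha : π x = a
    · rw [ha, swap_apply_left] at h1
      rw [ha]
      exact h1.trans hab.symm
    by_cases hb : π x = b
    · rw [hb, swap_apply_right] at h1
      rw [hb]
      exact h1.trans hab
    rwa [swap_apply_of_ne_of_ne ha hb] at h1
  have sub : ∀ {x y}, SameCycle π x y → SameCycle (swap a b * π) x y := by
    intro x y hxy
    exact hxy.mem_of_forall_mem (P := {z | SameCycle (swap a b * π) x z})
      (fun z hz => SameCycle.trans hz (step z)) (SameCycle.refl _ _)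
  constructor
  · intro hxy
    refine hxy.mem_of_forall_mem (P := {z | SameCycle π x z ∨
      ((SameCycle π a x ∨ SameCycle π b x) ∧ (SameCycle π a z ∨ SameCycle π b z))}) ?_
      (Or.inl (SameCycle.refl _ _))
    intro z hz
    simp only [Set.mem_ofPred_eq, mul_apply] at hz ⊢
    by_cases ha : π z = a
    · rw [ha, swap_apply_left]
      refine Or.inr ⟨?_, Or.inr (SameCycle.refl _ _)⟩
      rcases hz with hz | hz
      · left
        rw [← ha, sameCycle_apply_left]
        exact hz.symm
      · exact hz.1
    by_cases hb : π z = b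
    · rw [hb, swap_apply_right]
      refine Or.inr ⟨?_, Or.inl (SameCycle.refl _ _)⟩
      rcases hz with hz | hz
      · right
        rw [← hb, sameCycle_apply_left]
        exact hz.symm
      · exact hz.1
    rw [swap_apply_of_ne_of_ne ha hb]
    simpa only [sameCycle_apply_right] using hz
  · rintro (hxy | ⟨hx | hx, hy | hy⟩)
    · exact sub hxy
    · exact sub (hx.symm.trans hy)
    · exact (sub hx).symm.trans (hab.trans (sub hy))
    · exact (sub hx).symm.trans (hab.symm.trans (sub hy))
    · exact sub (hx.symm.trans hy)

theorem orbitCount_swap_mul_of_not_sameCycle [Finite X] {π : Perm X} {a b : X}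
    (h : ¬ SameCycle π a b) : (swap a b * π).orbitCount + 1 = π.orbitCount := by
  classical
  set q : X → Quotient (SameCycle.setoid π) := Quotient.mk _ with hq
  let f : {c : Quotient (SameCycle.setoid π) // c ≠ q b} →
      Quotient (SameCycle.setoid (swap a b * π)) := fun c =>
    Quotient.map' (s₁ := SameCycle.setoid π) (s₂ := SameCycle.setoid (swap a b * π)) id
      (fun _ _ hxy => (sameCycle_swap_mul_iff h).2 (Or.inl hxy)) c.1
  have hf : Function.Bijective f := by
    constructor
    · rintro ⟨c, hc⟩ ⟨d, hd⟩ hcd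
      induction c using Quotient.inductionOn with | _ x
      induction d using Quotient.inductionOn with | _ y
      have hxy : SameCycle (swap a b * π) x y := Quotient.exact hcd
      have hx : ¬ SameCycle π b x := fun hx => hc (Quotient.sound hx.symm)
      have hy : ¬ SameCycle π b y := fun hy => hd (Quotient.sound hy.symm)
      refine Subtype.ext (Quotient.sound ?_)
      rcases (sameCycle_swap_mul_iff h).1 hxy with hxy | ⟨hx' | hx', hy' | hy'⟩
      · exact hxy
      · exact hx'.symm.trans hy'
      all_goals contradiction
    · intro c
      induction c using Quotient.inductionOn with | _ x
      by_cases hx : SameCycle π b x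
      · exact ⟨⟨q a, fun hab => h (Quotient.exact hab)⟩, Quotient.sound
          ((sameCycle_swap_mul_iff h).2
            (Or.inr ⟨Or.inl (SameCycle.refl _ _), Or.inr hx⟩))⟩
      · exact ⟨⟨q x, fun hxb => hx (Quotient.exact hxb).symm⟩, rfl⟩
  rw [orbitCount, orbitCount, ← Nat.card_congr (Equiv.ofBijective f hf)]
  have := Fintype.ofFinite (Quotient (SameCycle.setoid π))
  have hpos : 0 < Fintype.card (Quotient (SameCycle.setoid π)) := Fintype.card_pos_iff.2 ⟨q b⟩
  rw [Nat.card_eq_fintype_card, Nat.card_eq_fintype_card, Fintype.card_subtype_compl,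
    Fintype.card_subtype_eq]
  omega

/-- If `k` is the first positive time at which `π` carries `a` to `b`, the segment of the first `k`
points from `a` is closed under the new permutation, since the step to `b` is diverted to `a`. -/
theorem not_sameCycle_swap_mul_self [Finite X] {π : Perm X} {a b : X} (hab : a ≠ b)
    (h : SameCycle π a b) : ¬ SameCycle (swap a b * π) a b := by
  obtain ⟨k, hk, hkb, hmin⟩ := h.exists_minimal_pow
  intro h'
  have hb : b ∈ {x | ∃ i, i < k ∧ (π ^ i) a = x} := by
    refine h'.mem_of_forall_mem ?_ ⟨0, hk, rfl⟩
    rintro _ ⟨i, hi, rfl⟩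
    rw [mul_apply, ← mul_apply π, ← pow_succ']
    rcases (show i + 1 < k ∨ i + 1 = k by omega) with hik | hik
    · refine ⟨i + 1, hik, ?_⟩
      rw [swap_apply_of_ne_of_ne ?_ (hmin _ (by omega) hik)]
      intro ha
      refine hmin (k - (i + 1)) (by omega) (by omega) ?_
      rw [← hkb]
      nth_rw 1 [← ha]
      rw [← mul_apply, ← pow_add]
      congr 2
      omega
    · refine ⟨0, hk, ?_⟩
      rw [hik, hkb, swap_apply_right]
      rfl
  obtain ⟨i, hi, hib⟩ := hb
  rcases Nat.eq_zero_or_pos i with rfl | hi0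
  · exact hab hib
  · exact hmin i hi0 hi hib

theorem orbitCount_swap_mul_of_sameCycle [Finite X] {π : Perm X} {a b : X} (hab : a ≠ b)
    (h : SameCycle π a b) : (swap a b * π).orbitCount = π.orbitCount + 1 := by
  have := orbitCount_swap_mul_of_not_sameCycle (not_sameCycle_swap_mul_self hab h)
  rw [swap_mul_self_mul] at this
  exact this.symm

omit [DecidableEq X] in
theorem not_sameCycle_of_apply_eq {π : Perm X} {x y : X} (hx : π x = x) (hxy : x ≠ y) :
    ¬ SameCycle π x y :=
  fun h => hxy (h.eq_of_left hx)

omit [DecidableEq X] in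
theorem orbitCount_one [Finite X] : (1 : Perm X).orbitCount = Nat.card X := by
  refine (Nat.card_congr (Equiv.ofBijective (Quotient.mk (SameCycle.setoid (1 : Perm X)))
    ⟨fun x y h => ?_, Quotient.mk_surjective⟩)).symm
  exact sameCycle_one.1 (Quotient.exact h)

omit [DecidableEq X] in
theorem sameCycle_iff_of_semiconj {Y : Type*} [Finite X] [Finite Y] {π : Perm X} {ρ : Perm Y}
    {f : X → Y} (hf : Function.Injective f) (h : ∀ x, ρ (f x) = f (π x)) (x x' : X) :
    SameCycle ρ (f x) (f x') ↔ SameCycle π x x' := by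
  have hpow : ∀ (n : ℕ) x, (ρ ^ n) (f x) = f ((π ^ n) x) := by
    intro n x
    induction n with
    | zero => rfl
    | succ n ih => rw [pow_succ', mul_apply, ih, h, pow_succ', mul_apply]
  constructor
  · intro hxy
    obtain ⟨n, hn⟩ := hxy.exists_nat_pow_eq
    exact ⟨n, hf (by rw [zpow_natCast, ← hpow, hn])⟩
  · intro hxy
    obtain ⟨n, hn⟩ := hxy.exists_nat_pow_eq
    exact ⟨n, by rw [zpow_natCast, hpow, hn]⟩

omit [DecidableEq X] in
/-- If `f` embeds the action of `π` in that of `ρ`, and `ρ` fixes all points outside the range of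
`f`, then `ρ` has one orbit more than `π` for each of these points. -/
theorem orbitCount_eq_add_of_semiconj {Y : Type*} [Finite X] [Finite Y]
    {π : Perm X} {ρ : Perm Y} {f : X → Y} (hf : Function.Injective f)
    (h : ∀ x, ρ (f x) = f (π x)) (hfix : ∀ y, y ∉ Set.range f → ρ y = y) :
    ρ.orbitCount = π.orbitCount + (Set.range f)ᶜ.ncard := by
  have hsame := sameCycle_iff_of_semiconj hf h
  let g : Quotient (SameCycle.setoid π) ⊕ ((Set.range f)ᶜ : Set Y) →
      Quotient (SameCycle.setoid ρ) :=
    Sum.elim (Quotient.map' (s₁ := SameCycle.setoid π) (s₂ := SameCycle.setoid ρ) f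
      (fun x x' hx => (hsame x x').2 hx)) (fun y => Quotient.mk _ y.1)
  have hg : Function.Bijective g := by
    constructor
    · rintro (c | ⟨y, hy⟩) (d | ⟨z, hz⟩) hcd
      · induction c using Quotient.inductionOn with | _ x
        induction d using Quotient.inductionOn with | _ x'
        exact congrArg Sum.inl (Quotient.sound ((hsame x x').1 (Quotient.exact hcd)))
      · induction c using Quotient.inductionOn with | _ x
        have : SameCycle ρ (f x) z := Quotient.exact hcd
        exact absurd ⟨x, this.eq_of_right (hfix z hz)⟩ hz
      · induction d using Quotient.inductionOn with | _ x
        have : SameCycle ρ y (f x) := Quotient.exact hcd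
        exact absurd ⟨x, (this.eq_of_left (hfix y hy)).symm⟩ hy
      · have : SameCycle ρ y z := Quotient.exact hcd
        have := this.eq_of_left (hfix y hy)
        subst this
        rfl
    · intro c
      induction c using Quotient.inductionOn with | _ y
      by_cases hy : y ∈ Set.range f
      · obtain ⟨x, rfl⟩ := hy
        exact ⟨Sum.inl (Quotient.mk _ x), rfl⟩
      · exact ⟨Sum.inr ⟨y, hy⟩, rfl⟩
  rw [orbitCount, ← Nat.card_congr (Equiv.ofBijective g hg), Nat.card_sum, orbitCount,
    Nat.card_coe_set_eq]

section AddEdge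

variable [Finite X] {π : Perm X} {d d' a b : X}

/-- This is the insertion of an edge with darts `d`, `d'` at the corners `a`, `b`, seen on the face
permutation. The first transposition joins `d` and `d'`, the second joins them to the cycle of `b`,
and the third splits, because `a` already lies in that cycle. As `d` and `d'` were two orbits
before, one orbit fewer means one face more. -/
theorem swap_triple_mul_of_sameCycle (hd : π d = d) (hd' : π d' = d') (hdd : d ≠ d')
    (had : a ≠ d) (had' : a ≠ d') (hbd : b ≠ d) (hbd' : b ≠ d') (h : SameCycle π a b) :
    (swap d a * (swap d' b * (swap d d' * π))).orbitCount + 1 = π.orbitCount ∧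
      ¬ SameCycle (swap d a * (swap d' b * (swap d d' * π))) d a ∧
      ¬ SameCycle (swap d a * (swap d' b * (swap d d' * π))) d d' := by
  have h1 : ¬ SameCycle π d d' := not_sameCycle_of_apply_eq hd hdd
  have hda := not_sameCycle_of_apply_eq hd had.symm
  have hdb := not_sameCycle_of_apply_eq hd hbd.symm
  have hda' := not_sameCycle_of_apply_eq hd' had'.symm
  have hdb' := not_sameCycle_of_apply_eq hd' hbd'.symm
  have h2 : ¬ SameCycle (swap d d' * π) d' b := by
    rw [sameCycle_swap_mul_iff h1]
    tauto
  have h3 : SameCycle (swap d' b * (swap d d' * π)) d a := by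
    rw [sameCycle_swap_mul_iff h2, sameCycle_swap_mul_iff h1, sameCycle_swap_mul_iff h1,
      sameCycle_swap_mul_iff h1, sameCycle_swap_mul_iff h1, sameCycle_swap_mul_iff h1]
    exact Or.inr ⟨Or.inl (Or.inr ⟨Or.inr (SameCycle.refl _ _), Or.inl (SameCycle.refl _ _)⟩),
      Or.inr (Or.inl h.symm)⟩
  have e1 := orbitCount_swap_mul_of_not_sameCycle h1
  have e2 := orbitCount_swap_mul_of_not_sameCycle h2
  have e3 := orbitCount_swap_mul_of_sameCycle had.symm h3
  have h4 := not_sameCycle_swap_mul_self had.symm h3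
  -- The new permutation maps `d'` to `a`, so a cycle through `d` and `d'` would contain `a`.
  refine ⟨by omega, h4, fun h5 => h4 (h5.trans ?_)⟩
  have : (swap d a * (swap d' b * (swap d d' * π))) d' = a := by
    rw [mul_apply, mul_apply, mul_apply, hd', swap_apply_right,
      swap_apply_of_ne_of_ne hdd hbd.symm, swap_apply_left]
  nth_rw 2 [← this]
  exact sameCycle_apply_right.2 (SameCycle.refl _ _)

/-- Now the third transposition joins as well: two faces and two fixed points become a single orbit,
so the number of faces drops by one. -/
theorem swap_triple_mul_of_not_sameCycle (hd : π d = d) (hd' : π d' = d') (hdd : d ≠ d')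
    (had : a ≠ d) (had' : a ≠ d') (hbd : b ≠ d) (hbd' : b ≠ d') (h : ¬ SameCycle π a b) :
    (swap d a * (swap d' b * (swap d d' * π))).orbitCount + 3 = π.orbitCount ∧
      SameCycle (swap d a * (swap d' b * (swap d d' * π))) d d' ∧
      ∀ x, SameCycle (swap d a * (swap d' b * (swap d d' * π))) d x →
        x = d ∨ x = d' ∨ SameCycle π a x ∨ SameCycle π b x := by
  have h1 : ¬ SameCycle π d d' := not_sameCycle_of_apply_eq hd hdd
  have hda := not_sameCycle_of_apply_eq hd had.symm
  have hdb := not_sameCycle_of_apply_eq hd hbd.symm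
  have hda' := not_sameCycle_of_apply_eq hd' had'.symm
  have hdb' := not_sameCycle_of_apply_eq hd' hbd'.symm
  have h2 : ¬ SameCycle (swap d d' * π) d' b := by
    rw [sameCycle_swap_mul_iff h1]
    tauto
  have h3 : ¬ SameCycle (swap d' b * (swap d d' * π)) d a := by
    rw [sameCycle_swap_mul_iff h2, sameCycle_swap_mul_iff h1, sameCycle_swap_mul_iff h1,
      sameCycle_swap_mul_iff h1, sameCycle_swap_mul_iff h1, sameCycle_swap_mul_iff h1]
    simp only [hda, hda', hdb, hdb', h1, or_false, false_or, and_false]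
    exact fun h' => h h'.2.symm
  have e1 := orbitCount_swap_mul_of_not_sameCycle h1
  have e2 := orbitCount_swap_mul_of_not_sameCycle h2
  have e3 := orbitCount_swap_mul_of_not_sameCycle h3
  refine ⟨by omega, (sameCycle_swap_mul_iff h3).2 (Or.inl ((sameCycle_swap_mul_iff h2).2
    (Or.inl (sameCycle_swap_mul_self_of_not_sameCycle h1)))), fun x hx => ?_⟩
  have hxd : SameCycle π d x → x = d := fun hx => (hx.eq_of_left hd).symm
  have hxd' : SameCycle π d' x → x = d' := fun hx => (hx.eq_of_left hd').symm
  rw [sameCycle_swap_mul_iff h3] at hx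
  simp only [sameCycle_swap_mul_iff h2, sameCycle_swap_mul_iff h1] at hx
  clear h1 h2 h3 e1 e2 e3 hda hdb hda' hdb'
  generalize SameCycle π a x = p1, SameCycle π b x = p2, SameCycle π d x = p3,
    SameCycle π d' x = p4 at *
  rcases hx with hx | ⟨-, hx⟩
  · rcases hx with (hx | ⟨-, hx⟩) | ⟨-, (hx | ⟨-, hx⟩) | (hx | ⟨-, hx⟩)⟩ <;> tauto
  · rcases hx with ((hx | ⟨-, hx⟩) | ⟨-, (hx | ⟨-, hx⟩) | (hx | ⟨-, hx⟩)⟩) |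
      ((hx | ⟨-, hx⟩) | ⟨-, (hx | ⟨-, hx⟩) | (hx | ⟨-, hx⟩)⟩) <;> tauto

end AddEdge

end Equiv.Perm

/-! ### Rotation systems with half-edges; inserting and deleting darts and edges -/

namespace RotationSystem

open Equiv Equiv.Perm

/-- The darts of a multigraph with edges `E` and vertices `V`: two for each edge, and a half-edge
at each vertex. -/
abbrev Dart (E V : Type*) := (E × Bool) ⊕ V

variable {E V : Type*}

/-- The vertex of a dart. -/
def vert (en : E × Bool → V) : Dart E V → V := Sum.elim en id

@[simp] theorem vert_inl (en : E × Bool → V) (q : E × Bool) : vert en (Sum.inl q) = en q := rfl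

@[simp] theorem vert_inr (en : E × Bool → V) (x : V) : vert en (Sum.inr x) = x := rfl

/-- The darts of the edges in `S` and the half-edges at the vertices in `H`. -/
def darts (S : Finset E) (H : Set V) : Set (Dart E V) :=
  {d | Sum.elim (fun q : E × Bool => q.1 ∈ S) (· ∈ H) d}

@[simp] theorem inl_mem_darts {S : Finset E} {H : Set V} {q : E × Bool} :
    (Sum.inl q : Dart E V) ∈ darts S H ↔ q.1 ∈ S := Iff.rfl

@[simp] theorem inr_mem_darts {S : Finset E} {H : Set V} {x : V} :
    (Sum.inr x : Dart E V) ∈ darts S H ↔ x ∈ H := Iff.rfl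

/-- The involution that exchanges the two darts of each edge in `S`. -/
def flip [DecidableEq E] (S : Finset E) : Perm (Dart E V) :=
  Function.Involutive.toPerm
    (Sum.elim (fun q : E × Bool => Sum.inl (if q.1 ∈ S then (q.1, !q.2) else q)) Sum.inr) (by
      rintro (⟨e, s⟩ | x)
      · by_cases he : e ∈ S <;> simp [he]
      · rfl)

/-- A rotation system on the darts in `Q`: its cycles on `Q` are the vertices. -/
structure IsRotation (vt : Dart E V → V) (Q : Set (Dart E V)) (σ : Perm (Dart E V)) : Prop where
  apply_eq : ∀ d ∉ Q, σ d = d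
  sameCycle_iff : ∀ d ∈ Q, ∀ d' ∈ Q, (SameCycle σ d d' ↔ vt d = vt d')

section Flip

variable [DecidableEq E] {S : Finset E}

theorem flip_inl_of_mem {e : E} (he : e ∈ S) (s : Bool) :
    (flip S : Perm (Dart E V)) (Sum.inl (e, s)) = Sum.inl (e, !s) :=
  congrArg Sum.inl (if_pos he)

theorem flip_inl_of_notMem {e : E} (he : e ∉ S) (s : Bool) :
    (flip S : Perm (Dart E V)) (Sum.inl (e, s)) = Sum.inl (e, s) :=
  congrArg Sum.inl (if_neg he)

theorem flip_inr (x : V) : (flip S : Perm (Dart E V)) (Sum.inr x) = Sum.inr x := rfl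

theorem flip_mem_darts {H : Set V} {d : Dart E V} (hd : d ∈ darts S H) :
    flip S d ∈ darts S H := by
  rcases d with ⟨e, s⟩ | x
  · rw [flip_inl_of_mem hd]
    exact hd
  · exact hd

theorem flip_insert [DecidableEq V] {e : E} (he : e ∉ S) (s : Bool) :
    (flip (insert e S) : Perm (Dart E V)) =
      swap (Sum.inl (e, s)) (Sum.inl (e, !s)) * flip S := by
  ext1 d
  rcases d with ⟨f, t⟩ | x
  · by_cases hf : f = e
    · subst hf
      rw [flip_inl_of_mem (Finset.mem_insert_self _ _), mul_apply, flip_inl_of_notMem he]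
      cases s <;> cases t <;> simp
    · have hne : ∀ u v, (Sum.inl (f, u) : Dart E V) ≠ Sum.inl (e, v) := by simp [hf]
      by_cases hfS : f ∈ S
      · rw [flip_inl_of_mem (Finset.mem_insert_of_mem hfS), mul_apply, flip_inl_of_mem hfS,
          swap_apply_of_ne_of_ne (hne _ _) (hne _ _)]
      · rw [flip_inl_of_notMem (by simp [hf, hfS]), mul_apply, flip_inl_of_notMem hfS,
          swap_apply_of_ne_of_ne (hne _ _) (hne _ _)]
  · rw [flip_inr, mul_apply, flip_inr, swap_apply_of_ne_of_ne (by simp) (by simp)]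

theorem flip_empty : (flip (∅ : Finset E) : Perm (Dart E V)) = 1 := by
  ext1 d
  rcases d with ⟨e, s⟩ | x
  · exact flip_inl_of_notMem (by simp) s
  · rfl

end Flip

namespace IsRotation

variable {vt : Dart E V → V} {Q : Set (Dart E V)} {σ : Perm (Dart E V)}

theorem apply_mem (h : IsRotation vt Q σ) {d : Dart E V} (hd : d ∈ Q) : σ d ∈ Q := by
  by_contra hn
  have := σ.injective (h.apply_eq _ hn)
  rw [this] at hn
  exact hn hd

theorem vert_apply (h : IsRotation vt Q σ) {d : Dart E V} (hd : d ∈ Q) : vt (σ d) = vt d :=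
  ((h.sameCycle_iff _ hd _ (h.apply_mem hd)).1 (sameCycle_apply_right.2 (SameCycle.refl _ _))).symm

variable [Finite E] [Finite V] [DecidableEq E] [DecidableEq V]

/-- The dart `q` is placed just before `a` in the cyclic order at their vertex. -/
theorem insert_dart (h : IsRotation vt Q σ) {q a : Dart E V} (hq : q ∉ Q) (ha : a ∈ Q)
    (hqa : vt q = vt a) : IsRotation vt (insert q Q) (swap q a * σ) := by
  have hne : q ≠ a := fun h => hq (h ▸ ha)
  have hσq := h.apply_eq q hq
  have hn : ¬ SameCycle σ q a := not_sameCycle_of_apply_eq hσq hne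
  refine ⟨fun d hd => ?_, ?_⟩
  · rw [Set.mem_insert_iff, not_or] at hd
    rw [mul_apply, h.apply_eq d hd.2, swap_apply_of_ne_of_ne hd.1 (fun h => hd.2 (h ▸ ha))]
  · have hx : ∀ x ∈ insert q Q, (SameCycle σ q x ∨ SameCycle σ a x) ↔ vt x = vt a := by
      rintro x (rfl | hx)
      · simp [hqa, SameCycle.refl]
      · rw [h.sameCycle_iff _ ha _ hx]
        have : ¬ SameCycle σ q x := not_sameCycle_of_apply_eq hσq (fun h => hq (h ▸ hx))
        simp [this, eq_comm]
    intro x hxQ y hyQ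
    rw [sameCycle_swap_mul_iff hn, hx x hxQ, hx y hyQ]
    rcases hxQ with rfl | hxQ <;> rcases hyQ with rfl | hyQ
    · simp [SameCycle.refl]
    · have : ¬ SameCycle σ x y := not_sameCycle_of_apply_eq hσq (fun h => hq (h ▸ hyQ))
      simp [this, hqa, eq_comm]
    · have : ¬ SameCycle σ x y := fun h' =>
        not_sameCycle_of_apply_eq hσq (fun h => hq (h ▸ hxQ)) h'.symm
      simp [this, hqa]
    · rw [h.sameCycle_iff _ hxQ _ hyQ]
      constructor
      · rintro (h1 | ⟨h1, h2⟩)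
        · exact h1
        · rw [h1, h2]
      · exact Or.inl

theorem delete_dart (h : IsRotation vt Q σ) {q : Dart E V} (hσq : σ q ≠ q) :
    IsRotation vt (Q \ {q}) (swap q (σ q) * σ) := by
  set σ' := swap q (σ q) * σ with hσ'
  have hq : σ' q = q := by simp [hσ']
  have hqQ : q ∈ Q := by
    by_contra hn
    exact hσq (h.apply_eq q hn)
  have hn : ¬ SameCycle σ' q (σ q) := not_sameCycle_of_apply_eq hq hσq.symm
  have hσσ : σ = swap q (σ q) * σ' := by rw [hσ', swap_mul_self_mul]
  refine ⟨fun d hd => ?_, ?_⟩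
  · by_cases hdq : d = q
    · rw [hdq, hq]
    · have hdQ : d ∉ Q := fun hdQ => hd ⟨hdQ, hdq⟩
      rw [hσ', mul_apply, h.apply_eq d hdQ, swap_apply_of_ne_of_ne hdq]
      exact fun h' => hdQ (h' ▸ h.apply_mem hqQ)
  · rintro x ⟨hxQ, hxq⟩ y ⟨hyQ, hyq⟩
    have hx : ¬ SameCycle σ' q x := not_sameCycle_of_apply_eq hq (fun h => hxq h.symm)
    have hy : ¬ SameCycle σ' q y := not_sameCycle_of_apply_eq hq (fun h => hyq h.symm)
    have hiff := sameCycle_swap_mul_iff hn (x := x) (y := y)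
    rw [← hσσ] at hiff
    rw [← h.sameCycle_iff x hxQ y hyQ, hiff]
    simp only [hx, hy, false_or]
    constructor
    · exact Or.inl
    · rintro (h1 | ⟨h1, h2⟩)
      · exact h1
      · exact h1.symm.trans h2

end IsRotation

section Edge

variable [Finite E] [Finite V] [DecidableEq E] [DecidableEq V] {en : E × Bool → V}
  {S : Finset E} {σ : Perm (Dart E V)} {e : E}

omit [Finite E] [Finite V] [DecidableEq V] in
theorem darts_insert (S : Finset E) (H : Set V) (e : E) (s : Bool) :
    darts (insert e S) H = insert (Sum.inl (e, s)) (insert (Sum.inl (e, !s)) (darts S H)) := by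
  ext d
  rcases d with ⟨f, t⟩ | x
  · cases s <;> cases t <;> simp
  · simp

omit [Finite E] [Finite V] in
-- As `σ` fixes both darts of `e`, their transposition commutes with `σ`. An insertion thus becomes
-- three transpositions applied to the old face permutation.
theorem face_insert (hσ : ∀ s, σ (Sum.inl (e, s)) = Sum.inl (e, s)) (he : e ∉ S) (s : Bool)
    (a b : Dart E V) :
    (swap (Sum.inl (e, s)) a * (swap (Sum.inl (e, !s)) b * σ)) * flip (insert e S) =
      swap (Sum.inl (e, s)) a * (swap (Sum.inl (e, !s)) b *
        (swap (Sum.inl (e, s)) (Sum.inl (e, !s)) * (σ * flip S))) := by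
  have := mul_swap_eq_swap_mul σ (Sum.inl (e, s)) (Sum.inl (e, !s))
  rw [hσ, hσ] at this
  rw [flip_insert he s, mul_assoc, mul_assoc, ← mul_assoc σ, this, mul_assoc]

theorem IsRotation.insert_edge (h : IsRotation (vert en) (darts S Set.univ) σ) (he : e ∉ S)
    {s : Bool} {a b : Dart E V} (ha : a ∈ darts S Set.univ) (hb : b ∈ darts S Set.univ)
    (hae : vert en a = en (e, s)) (hbe : vert en b = en (e, !s)) :
    IsRotation (vert en) (darts (insert e S) Set.univ)
      (swap (Sum.inl (e, s)) a * (swap (Sum.inl (e, !s)) b * σ)) := by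
  rw [darts_insert S Set.univ e s]
  exact (h.insert_dart (q := Sum.inl (e, !s)) (by simpa using he) hb hbe.symm).insert_dart
    (q := Sum.inl (e, s)) (by simpa using he) (Set.mem_insert_of_mem _ ha) hae.symm

/-- A deletion is presented as the undoing of an insertion, so that the insertion lemmas also
compute its effect on faces. The condition `hs` ensures that the successor `a` of the first dart
survives the deletion. -/
theorem IsRotation.delete_edge (h : IsRotation (vert en) (darts (insert e S) Set.univ) σ)
    (he : e ∉ S) {s : Bool} (hs : σ (Sum.inl (e, s)) ≠ Sum.inl (e, !s)) :
    ∃ σ' a b, IsRotation (vert en) (darts S Set.univ) σ' ∧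
      a ∈ darts S Set.univ ∧ b ∈ darts S Set.univ ∧
      vert en a = en (e, s) ∧ vert en b = en (e, !s) ∧
      σ = swap (Sum.inl (e, s)) a * (swap (Sum.inl (e, !s)) b * σ') ∧
      a = σ (Sum.inl (e, s)) ∧
      (σ (Sum.inl (e, !s)) ≠ Sum.inl (e, s) → b = σ (Sum.inl (e, !s))) := by
  have hdd : (Sum.inl (e, s) : Dart E V) ≠ Sum.inl (e, !s) := by simp
  have hmem : ∀ t, (Sum.inl (e, t) : Dart E V) ∈ darts (insert e S) Set.univ := by simp
  -- The half-edge at its vertex keeps a dart from being alone in its cycle, so each deleted dart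
  -- has a proper successor.
  have hfix : ∀ {Q : Set (Dart E V)} {τ : Perm (Dart E V)}, IsRotation (vert en) Q τ →
      ∀ t, Sum.inl (e, t) ∈ Q → Sum.inr (en (e, t)) ∈ Q →
        τ (Sum.inl (e, t)) ≠ Sum.inl (e, t) := by
    intro Q τ h t h1 h2 h3
    have := ((h.sameCycle_iff _ h1 _ h2).2 rfl).eq_of_left h3
    simp at this
  have hd := hfix h s (hmem s) (by simp)
  have h1 := h.delete_dart hd
  have hmem1 : (Sum.inl (e, !s) : Dart E V) ∈
      darts (insert e S) Set.univ \ {Sum.inl (e, s)} := by simp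
  have hd' := hfix h1 (!s) hmem1 (by simp)
  have h2 := h1.delete_dart hd'
  have hQ : (darts (insert e S) Set.univ \ {Sum.inl (e, s)}) \ {Sum.inl (e, !s)} =
      (darts S Set.univ : Set (Dart E V)) := by
    ext d
    rcases d with ⟨f, t⟩ | x
    · by_cases hf : f = e
      · subst hf
        cases s <;> cases t <;> simp [he]
      · simp [hf]
    · simp
  have hbm := h1.apply_mem hmem1
  have hbv := h1.vert_apply hmem1
  set d : Dart E V := Sum.inl (e, s) with hd_def
  set d' : Dart E V := Sum.inl (e, !s) with hd'_def
  rw [hQ] at h2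
  refine ⟨_, σ d, _, h2, ?_, ?_, h.vert_apply (hmem s), hbv, ?_, rfl, ?_⟩
  · rw [← hQ]
    exact ⟨⟨h.apply_mem (hmem s), hd⟩, hs⟩
  · rw [← hQ]
    exact ⟨hbm, hd'⟩
  · rw [swap_mul_self_mul, swap_mul_self_mul]
  · intro hne
    rw [mul_apply, swap_apply_of_ne_of_ne hne]
    exact fun h' => hdd (σ.injective h').symm

end Edge

end RotationSystem

/-! ### Numbers of faces when edges are added -/

namespace RotationSystem

open Equiv Equiv.Perm

variable {E V : Type*} [Finite E] [Finite V] [DecidableEq E] [DecidableEq V]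
  {en : E × Bool → V} {S : Finset E} {σ : Perm (Dart E V)} {e f : E}

/-- The permutation whose cycles are the faces. -/
def facePerm (σ : Perm (Dart E V)) (S : Finset E) : Perm (Dart E V) := σ * flip S

theorem IsRotation.facePerm_mem (h : IsRotation (vert en) (darts S Set.univ) σ) {d : Dart E V}
    (hd : d ∈ darts S Set.univ) : facePerm σ S d ∈ darts S Set.univ :=
  h.apply_mem (flip_mem_darts hd)

theorem IsRotation.vert_facePerm (h : IsRotation (vert en) (darts S Set.univ) σ) {d : Dart E V}
    (hd : d ∈ darts S Set.univ) : vert en (facePerm σ S d) = vert en (flip S d) :=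
  h.vert_apply (flip_mem_darts hd)

theorem IsRotation.apply_inl (h : IsRotation (vert en) (darts S Set.univ) σ) (he : e ∉ S)
    (t : Bool) : σ (Sum.inl (e, t)) = Sum.inl (e, t) :=
  h.apply_eq _ (by simpa using he)

theorem IsRotation.facePerm_inl (h : IsRotation (vert en) (darts S Set.univ) σ) (he : e ∉ S)
    (t : Bool) : facePerm σ S (Sum.inl (e, t)) = Sum.inl (e, t) := by
  rw [facePerm, mul_apply, flip_inl_of_notMem he, h.apply_inl he]

theorem ne_inl_of_mem_darts {H : Set V} (he : e ∉ S) {a : Dart E V} (ha : a ∈ darts S H)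
    (t : Bool) : a ≠ Sum.inl (e, t) := by
  rintro rfl
  exact he ha

theorem IsRotation.facePerm_insert_of_sameCycle (h : IsRotation (vert en) (darts S Set.univ) σ)
    (he : e ∉ S) {s : Bool} {a b : Dart E V} (ha : a ∈ darts S Set.univ)
    (hb : b ∈ darts S Set.univ) (hab : SameCycle (facePerm σ S) a b)
    {σ' : Perm (Dart E V)} (hσ' : σ' = swap (Sum.inl (e, s)) a * (swap (Sum.inl (e, !s)) b * σ)) :
    (facePerm σ' (insert e S)).orbitCount + 1 = (facePerm σ S).orbitCount ∧
      ¬ SameCycle (facePerm σ' (insert e S)) (Sum.inl (e, s)) a ∧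
      ¬ SameCycle (facePerm σ' (insert e S)) (Sum.inl (e, s)) (Sum.inl (e, !s)) := by
  rw [hσ', facePerm, face_insert (h.apply_inl he) he]
  exact swap_triple_mul_of_sameCycle (h.facePerm_inl he s) (h.facePerm_inl he _) (by simp)
    (ne_inl_of_mem_darts he ha _) (ne_inl_of_mem_darts he ha _) (ne_inl_of_mem_darts he hb _)
    (ne_inl_of_mem_darts he hb _) hab

theorem IsRotation.facePerm_insert_of_not_sameCycle
    (h : IsRotation (vert en) (darts S Set.univ) σ)
    (he : e ∉ S) {s : Bool} {a b : Dart E V} (ha : a ∈ darts S Set.univ)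
    (hb : b ∈ darts S Set.univ) (hab : ¬ SameCycle (facePerm σ S) a b)
    {σ' : Perm (Dart E V)} (hσ' : σ' = swap (Sum.inl (e, s)) a * (swap (Sum.inl (e, !s)) b * σ)) :
    (facePerm σ' (insert e S)).orbitCount + 3 = (facePerm σ S).orbitCount ∧
      SameCycle (facePerm σ' (insert e S)) (Sum.inl (e, s)) (Sum.inl (e, !s)) ∧
      ∀ x, SameCycle (facePerm σ' (insert e S)) (Sum.inl (e, s)) x →
        x = Sum.inl (e, s) ∨ x = Sum.inl (e, !s) ∨ SameCycle (facePerm σ S) a x ∨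
          SameCycle (facePerm σ S) b x := by
  rw [hσ', facePerm, face_insert (h.apply_inl he) he]
  exact swap_triple_mul_of_not_sameCycle (h.facePerm_inl he s) (h.facePerm_inl he _) (by simp)
    (ne_inl_of_mem_darts he ha _) (ne_inl_of_mem_darts he ha _) (ne_inl_of_mem_darts he hb _)
    (ne_inl_of_mem_darts he hb _) hab

/-- The edges in `S` admit a rotation system for which the number of faces is at most `F` and of
the parity of `F`. -/
def FaceBound (en : E × Bool → V) (S : Finset E) (F : ℤ) : Prop :=
  ∃ σ : Perm (Dart E V), IsRotation (vert en) (darts S Set.univ) σ ∧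
    -- The darts of the edges outside `S` are fixed points of the face permutation; these 2|E| -
    -- 2|S| orbits are not faces.
    ∃ i : ℕ, ((facePerm σ S).orbitCount : ℤ) + 2 * S.card + 2 * i = F + 2 * Nat.card E

theorem IsRotation.eq_one (h : IsRotation (vert en) (darts ∅ Set.univ) σ) : σ = 1 := by
  ext1 d
  rcases d with ⟨e, t⟩ | x
  · exact h.apply_inl (by simp) t
  · have hx : (Sum.inr x : Dart E V) ∈ darts ∅ Set.univ := by simp
    have h1 := h.vert_apply hx
    have h2 := h.apply_mem hx
    rcases hd : σ (Sum.inr x) with ⟨e, t⟩ | y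
    · rw [hd] at h2
      simp at h2
    · rw [hd] at h1
      simp at h1
      simp [h1]

theorem isRotation_one : IsRotation (vert en) (darts ∅ Set.univ) 1 := by
  refine ⟨fun _ _ => rfl, ?_⟩
  rintro (q | x) hx (q' | y) hy
  all_goals simp [sameCycle_one] at hx hy ⊢

theorem orbitCount_facePerm_one :
    (facePerm (1 : Perm (Dart E V)) ∅).orbitCount = 2 * Nat.card E + Nat.card V := by
  rw [facePerm, flip_empty, mul_one, orbitCount_one, Nat.card_sum, Nat.card_prod, mul_comm]
  simp

theorem FaceBound.empty : FaceBound en ∅ (Nat.card V) := by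
  refine ⟨1, isRotation_one, 0, ?_⟩
  rw [orbitCount_facePerm_one]
  push_cast
  simp
  ring

theorem FaceBound.insert {F : ℤ} (h : FaceBound en S F) (he : e ∉ S) :
    FaceBound en (insert e S) (F + 1) := by
  obtain ⟨σ, hσ, i, hi⟩ := h
  have ha : (Sum.inr (en (e, false)) : Dart E V) ∈ darts S Set.univ := by simp
  have hb : (Sum.inr (en (e, true)) : Dart E V) ∈ darts S Set.univ := by simp
  have hσ' := hσ.insert_edge (s := false) he ha hb rfl rfl
  have hc := Finset.card_insert_of_notMem he
  by_cases hab : SameCycle (facePerm σ S) (Sum.inr (en (e, false))) (Sum.inr (en (e, true)))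
  · have h1 := (hσ.facePerm_insert_of_sameCycle (s := false) he ha hb hab rfl).1
    exact ⟨_, hσ', i, by rw [hc]; push_cast; linarith⟩
  -- Merging leaves two faces fewer than the bound `F + 1` allows for; the slack `i` absorbs them.
  · have h1 := (hσ.facePerm_insert_of_not_sameCycle (s := false) he ha hb hab rfl).1
    exact ⟨_, hσ', i + 1, by rw [hc]; push_cast; linarith⟩

/-- Two edges with a common vertex can be added without increasing the number of faces. -/
theorem FaceBound.insert_insert {F : ℤ} (h : FaceBound en S F) (he : e ∉ S) (hf : f ∉ S)
    (hef : e ≠ f) {s t : Bool} (hst : en (e, s) = en (f, t)) :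
    FaceBound en (Insert.insert f (Insert.insert e S)) F := by
  obtain ⟨σ, hσ, i, hi⟩ := h
  have ha : (Sum.inr (en (e, s)) : Dart E V) ∈ darts S Set.univ := by simp
  have hb : (Sum.inr (en (e, !s)) : Dart E V) ∈ darts S Set.univ := by simp
  have hσ' := hσ.insert_edge (s := s) he ha hb rfl rfl
  have hc := Finset.card_insert_of_notMem he
  by_cases hab : SameCycle (facePerm σ S) (Sum.inr (en (e, s))) (Sum.inr (en (e, !s)))
  · have h1 := hσ.facePerm_insert_of_sameCycle (s := s) he ha hb hab rfl
    have hf' : f ∉ Insert.insert e S := by simp [hf, hef.symm]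
    have hc' := Finset.card_insert_of_notMem hf'
    set σ' := swap (Sum.inl (e, s)) (Sum.inr (en (e, s))) *
      (swap (Sum.inl (e, !s)) (Sum.inr (en (e, !s))) * σ)
    set z : Dart E V := Sum.inr (en (f, !t))
    have hz : z ∈ darts (Insert.insert e S) Set.univ := by simp [z]
    -- The edge `e` has split a face, and the common vertex has a corner in each part. The other end
    -- `z` of `f` lies in at most one of them, so some corner makes `f` merge two faces.
    obtain ⟨a, ha', hav, haz⟩ : ∃ a ∈ darts (Insert.insert e S) Set.univ,
        vert en a = en (f, t) ∧ ¬ SameCycle (facePerm σ' (Insert.insert e S)) a z := by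
      by_cases hz : SameCycle (facePerm σ' (Insert.insert e S)) (Sum.inl (e, s)) z
      · exact ⟨Sum.inr (en (e, s)), by simp, hst, fun h => h1.2.1 (hz.trans h.symm)⟩
      · exact ⟨Sum.inl (e, s), by simp, hst, hz⟩
    have h2 := (hσ'.facePerm_insert_of_not_sameCycle (s := t) hf' ha' hz haz rfl).1
    refine ⟨_, hσ'.insert_edge (s := t) hf' ha' hz hav rfl, i, ?_⟩
    rw [hc', hc]
    push_cast
    linarith [h1.1]
  · have h1 := (hσ.facePerm_insert_of_not_sameCycle (s := s) he ha hb hab rfl).1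
    have : FaceBound en (Insert.insert e S) (F - 1) :=
      ⟨_, hσ', i, by rw [hc]; push_cast; linarith⟩
    have := this.insert (e := f) (by simp [hf, hef.symm])
    rwa [sub_add_cancel] at this

/-- An edge from an isolated vertex to another vertex joins two faces. -/
theorem FaceBound.insert_pendant {F : ℤ} (h : FaceBound en S (F + 1)) (he : e ∉ S) {s : Bool}
    (hne : en (e, s) ≠ en (e, !s)) (hiso : ∀ f ∈ S, ∀ t, en (f, t) ≠ en (e, s)) :
    FaceBound en (Insert.insert e S) F := by
  obtain ⟨σ, hσ, i, hi⟩ := h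
  have ha : (Sum.inr (en (e, s)) : Dart E V) ∈ darts S Set.univ := by simp
  have hb : (Sum.inr (en (e, !s)) : Dart E V) ∈ darts S Set.univ := by simp
  have hσ' := hσ.insert_edge (s := s) he ha hb rfl rfl
  have hc := Finset.card_insert_of_notMem he
  -- The face permutation carries a half-edge to a dart at the same vertex, and an isolated vertex
  -- has no other dart.
  have hfix : facePerm σ S (Sum.inr (en (e, s))) = Sum.inr (en (e, s)) := by
    have h1 := hσ.vert_facePerm ha
    have h2 := hσ.facePerm_mem ha
    rcases hd : facePerm σ S (Sum.inr (en (e, s))) with ⟨f, t⟩ | y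
    · rw [hd] at h1 h2
      exact absurd h1 (hiso f h2 t)
    · rw [hd] at h1
      exact congrArg Sum.inr h1
  have h1 := (hσ.facePerm_insert_of_not_sameCycle (s := s) he ha hb
    (not_sameCycle_of_apply_eq hfix (by simpa using hne)) rfl).1
  exact ⟨_, hσ', i, by rw [hc]; push_cast; linarith⟩

end RotationSystem

/-! ### Reduction of a rotation system to a spanning forest -/

namespace RotationSystem

open Equiv Equiv.Perm

variable {E V : Type*} [Finite E] [Finite V] [DecidableEq E] [DecidableEq V]
  {en : E × Bool → V} {S T : Finset E} {σ : Perm (Dart E V)} {e f : E}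

/-- The edges in `S \ T` can be added at the cost of at most `j` more faces. -/
structure Reduces (en : E × Bool → V) (T S : Finset E) (j : ℤ) : Prop where
  subset : T ⊆ S
  -- Allowing further edges `D` makes a reduction of one side valid inside the whole graph, and lets
  -- a pendant edge be set aside during an induction.
  bound : ∀ D : Finset E, Disjoint D S → ∀ F, FaceBound en (T ∪ D) F → FaceBound en (S ∪ D) (F + j)

/-- Some edge in `S` has exactly one end in `X`. -/
def Crosses (en : E × Bool → V) (S : Finset E) (X : Set V) : Prop :=
  ∃ e ∈ S, ∃ s, en (e, s) ∈ X ∧ en (e, !s) ∉ X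

/-- Every nonempty set of vertices spans fewer edges than it has elements: `T` is a forest. -/
def Sparse (en : E × Bool → V) (T : Finset E) : Prop :=
  ∀ A : Finset V, A.Nonempty → (T.filter fun e => ∀ s, en (e, s) ∈ A).card + 1 ≤ A.card

namespace Reduces

variable {j k : ℤ}

theorem refl (S : Finset E) : Reduces en S S 0 := by
  refine ⟨subset_rfl, fun D _ F h => ?_⟩
  rwa [add_zero]

theorem trans {U : Finset E} (h₁ : Reduces en T S j) (h₂ : Reduces en S U k) :
    Reduces en T U (j + k) := by
  refine ⟨h₁.subset.trans h₂.subset, fun D hD F h => ?_⟩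
  rw [← add_assoc]
  exact h₂.bound D hD _ (h₁.bound D (hD.mono_right h₂.subset) F h)

theorem insert (he : e ∉ S) : Reduces en S (insert e S) 1 := by
  refine ⟨Finset.subset_insert _ _, fun D hD F h => ?_⟩
  rw [Finset.disjoint_insert_right] at hD
  rw [Finset.insert_union]
  exact h.insert (by simp [he, hD.1])

theorem insert_insert (he : e ∉ S) (hf : f ∉ S) (hef : e ≠ f) {s t : Bool}
    (hst : en (e, s) = en (f, t)) :
    Reduces en S (Insert.insert f (Insert.insert e S)) 0 := by
  refine ⟨(Finset.subset_insert _ _).trans (Finset.subset_insert _ _), fun D hD F h => ?_⟩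
  rw [Finset.disjoint_insert_right, Finset.disjoint_insert_right] at hD
  rw [Finset.insert_union, Finset.insert_union, add_zero]
  exact h.insert_insert (by simp [he, hD]) (by simp [hf, hD]) hef hst

theorem insert_both (h : Reduces en T S j) (he : e ∉ S) :
    Reduces en (Insert.insert e T) (Insert.insert e S) j := by
  refine ⟨Finset.insert_subset_insert _ h.subset, fun D hD F hF => ?_⟩
  rw [Finset.disjoint_insert_right] at hD
  rw [Finset.insert_union, ← Finset.union_insert] at hF ⊢
  exact h.bound _ (by rw [Finset.disjoint_insert_left]; exact ⟨he, hD.2⟩) F hF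

/-- Any edges can be added at the cost of one face each. -/
theorem of_subset (h : T ⊆ S) : Reduces en T S ((S \ T).card : ℤ) := by
  induction S using Finset.strongInduction with
  | H S ih =>
    by_cases hST : S ⊆ T
    · rw [Finset.sdiff_eq_empty_iff_subset.2 hST, Finset.Subset.antisymm h hST]
      exact refl S
    · obtain ⟨e, heS, heT⟩ := Finset.not_subset.1 hST
      have h1 := ih (S.erase e) (Finset.erase_ssubset heS) (Finset.subset_erase.2 ⟨h, heT⟩)
      have h2 := h1.trans (insert (Finset.notMem_erase e S))
      rw [Finset.insert_erase heS] at h2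
      have h3 : ((S \ T).card : ℤ) = ((S.erase e \ T).card : ℤ) + 1 := by
        rw [Finset.erase_sdiff_comm, Finset.card_erase_of_mem (by simp [heS, heT])]
        have : 0 < (S \ T).card := Finset.card_pos.2 ⟨e, by simp [heS, heT]⟩
        omega
      rwa [h3]

end Reduces

theorem Crosses.mono {X : Set V} (h : T ⊆ S) : Crosses en T X → Crosses en S X :=
  fun ⟨e, he, h'⟩ => ⟨e, h he, h'⟩

/-- The new edge hangs on a vertex that `T` does not meet. A set `A` containing that vertex spans at
most one edge more than `A` without it. -/
theorem Sparse.insert (hT : Sparse en T) {s : Bool} (hne : en (e, s) ≠ en (e, !s))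
    (hiso : ∀ f ∈ T, ∀ t, en (f, t) ≠ en (e, s)) : Sparse en (insert e T) := by
  intro A hA
  by_cases hs : en (e, s) ∈ A
  · have h1 : (T.filter fun e => ∀ s, en (e, s) ∈ A) =
        T.filter fun f => ∀ t, en (f, t) ∈ A.erase (en (e, s)) := by
      refine Finset.filter_congr fun f hf => ⟨fun h t => ?_, fun h t => ?_⟩
      · exact Finset.mem_erase.2 ⟨hiso f hf t, h t⟩
      · exact Finset.mem_of_mem_erase (h t)
    rcases (A.erase (en (e, s))).eq_empty_or_nonempty with hA' | hA'
    · have h2 : ((Insert.insert e T).filter fun e => ∀ s, en (e, s) ∈ A) = ∅ := by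
        rw [Finset.filter_insert, h1, hA', if_neg]
        · simp
        · intro h
          have : en (e, !s) ∈ A.erase (en (e, s)) := Finset.mem_erase.2 ⟨hne.symm, h _⟩
          rw [hA'] at this
          simp at this
      rw [h2, Finset.card_empty, zero_add]
      exact hA.card_pos
    · have h2 := hT _ hA'
      have h3 : ((Insert.insert e T).filter fun e => ∀ s, en (e, s) ∈ A).card ≤
          (T.filter fun e => ∀ s, en (e, s) ∈ A).card + 1 := by
        rw [Finset.filter_insert]
        split_ifs
        · exact Finset.card_insert_le _ _
        · omega
      rw [h1] at h3
      have := Finset.card_erase_add_one hs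
      omega
  · rw [Finset.filter_insert, if_neg fun h => hs (h s)]
    exact hT A hA

/-- The boundary of a face moves only along edges, so it cannot leave a vertex set that no edge
crosses. Hence connectivity survives the deletion of an edge whose two corners end up in one face.
-/
theorem IsRotation.vert_mem_iff (h : IsRotation (vert en) (darts S Set.univ) σ) {X : Set V}
    (hX : ¬ Crosses en S X) {x y : Dart E V} (hx : x ∈ darts S Set.univ)
    (hxy : SameCycle (facePerm σ S) x y) : vert en y ∈ X ↔ vert en x ∈ X := by
  refine (hxy.mem_of_forall_mem (P := {z | z ∈ darts S Set.univ ∧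
    (vert en z ∈ X ↔ vert en x ∈ X)}) ?_ ⟨hx, Iff.rfl⟩).2
  rintro z ⟨hz, hzx⟩
  refine ⟨h.facePerm_mem hz, ?_⟩
  rw [h.vert_facePerm hz, ← hzx]
  rcases z with ⟨g, t⟩ | z
  · rw [flip_inl_of_mem hz, vert_inl, vert_inl]
    by_contra hcon
    apply hX
    by_cases ht : en (g, t) ∈ X
    · exact ⟨g, hz, t, ht, by tauto⟩
    · exact ⟨g, hz, !t, by tauto, by simpa using ht⟩
  · rfl

/-- Otherwise the two darts of `e` would form a whole cycle of `σ`, which misses the half-edge at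
their vertex. So one of the two directions of `e` always satisfies the condition of
`IsRotation.delete_edge`. -/
theorem IsRotation.apply_ne_of_swap (h : IsRotation (vert en) (darts S Set.univ) σ) {s : Bool}
    (he : e ∈ S) (h1 : σ (Sum.inl (e, s)) = Sum.inl (e, !s)) :
    σ (Sum.inl (e, !s)) ≠ Sum.inl (e, s) := by
  intro h2
  have h3 := ((h.sameCycle_iff (Sum.inl (e, s)) he (Sum.inr (en (e, s))) (by simp)).2 rfl)
  have h4 := h3.mem_of_forall_mem (P := {Sum.inl (e, s), Sum.inl (e, !s)}) (by
    rintro x (rfl | rfl)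
    · right; exact h1
    · left; exact h2) (by simp)
  simp at h4

/-- Deleting an edge with distinct faces on its two sides merges these faces. -/
theorem IsRotation.exists_delete_of_not_sameCycle
    (h : IsRotation (vert en) (darts (insert e S) Set.univ) σ) (he : e ∉ S) {s : Bool}
    (hs : ¬ SameCycle (facePerm σ (insert e S)) (Sum.inl (e, s)) (Sum.inl (e, !s))) :
    ∃ σ', IsRotation (vert en) (darts S Set.univ) σ' ∧
      (facePerm σ' S).orbitCount = (facePerm σ (insert e S)).orbitCount + 1 ∧
      ∀ X, Crosses en (insert e S) X → Crosses en S X := by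
  wlog hne : σ (Sum.inl (e, s)) ≠ Sum.inl (e, !s) generalizing s
  · push Not at hne
    refine this (s := !s) (fun h' => hs ?_) ?_
    · rw [Bool.not_not] at h'
      exact h'.symm
    · have := h.apply_ne_of_swap (Finset.mem_insert_self e S) hne
      rwa [Bool.not_not]
  obtain ⟨σ', a, b, hσ', ha, hb, hva, hvb, hσ, -, -⟩ := h.delete_edge he hne
  by_cases hab : SameCycle (facePerm σ' S) a b
  · refine ⟨σ', hσ', (hσ'.facePerm_insert_of_sameCycle he ha hb hab hσ).1.symm, ?_⟩
    rintro X ⟨g, hg, t, ht, ht'⟩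
    by_contra hX
    rcases Finset.mem_insert.1 hg with rfl | hg
    · have := hσ'.vert_mem_iff hX ha hab
      rw [hva, hvb] at this
      rcases Bool.eq_or_eq_not t s with rfl | rfl
      · tauto
      · rw [Bool.not_not] at ht'
        tauto
    · exact hX ⟨g, hg, t, ht, ht'⟩
  · exact absurd (hσ'.facePerm_insert_of_not_sameCycle he ha hb hab hσ).2.1 hs

theorem IsRotation.exists_minimal_dart (hS : S.Nonempty)
    (hall : ∀ e ∈ S, ∀ s, SameCycle (facePerm σ S) (Sum.inl (e, s)) (Sum.inl (e, !s))) :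
    ∃ e ∈ S, ∃ s k, 0 < k ∧ (facePerm σ S ^ k) (Sum.inl (e, s)) = Sum.inl (e, !s) ∧
      ∀ f ∈ S, ∀ t i, 0 < i → i < k → (facePerm σ S ^ i) (Sum.inl (f, t)) ≠ Sum.inl (f, !t) := by
  classical
  have hex : ∃ k, 0 < k ∧ ∃ e ∈ S, ∃ s,
      (facePerm σ S ^ k) (Sum.inl (e, s)) = Sum.inl (e, !s) := by
    obtain ⟨e, he⟩ := hS
    obtain ⟨k, hk, h, -⟩ := (hall e he false).exists_minimal_pow
    exact ⟨k, hk, e, he, false, h⟩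
  obtain ⟨hk, e, he, s, h⟩ := Nat.find_spec hex
  exact ⟨e, he, s, _, hk, h, fun f hf t i hi hik hft => Nat.find_min hex hik ⟨hi, f, hf, t, hft⟩⟩

theorem IsRotation.facePerm_pow_mem (h : IsRotation (vert en) (darts S Set.univ) σ)
    {d : Dart E V} (hd : d ∈ darts S Set.univ) (n : ℕ) :
    (facePerm σ S ^ n) d ∈ darts S Set.univ := by
  induction n with
  | zero => exact hd
  | succ n ih =>
    rw [pow_succ', mul_apply]
    exact h.facePerm_mem ih

/-- Every rotation system reduces to that of a spanning forest, by removing edges between distinct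
faces and pairs of edges with a common vertex. -/
theorem IsRotation.exists_reduces (h : IsRotation (vert en) (darts S Set.univ) σ) :
    ∃ (T : Finset E) (j : ℤ), Reduces en T S j ∧ (∀ X, Crosses en S X → Crosses en T X) ∧
      Sparse en T ∧
      -- With F = orbits - 2|E| + 2|S| faces this reads j = F - (|V| - |T|), where |V| - |T| is the
      -- number of components of the forest `T`.
      j + Nat.card V + 2 * Nat.card E = (facePerm σ S).orbitCount + 2 * S.card + T.card := by
  induction hn : S.card using Nat.strong_induction_on generalizing S σ with
  | _ n ih =>
  subst hn
  rcases S.eq_empty_or_nonempty with rfl | hS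
  · refine ⟨∅, 0, Reduces.refl _, fun X hX => hX, fun A hA => ?_, ?_⟩
    · simpa using hA.card_pos
    · rw [h.eq_one, orbitCount_facePerm_one]
      push_cast
      simp
      ring
  by_cases hex : ∃ e ∈ S, ∃ s, ¬ SameCycle (facePerm σ S) (Sum.inl (e, s)) (Sum.inl (e, !s))
  · obtain ⟨e, he, s, hs⟩ := hex
    obtain ⟨S', he', rfl⟩ : ∃ S', e ∉ S' ∧ S = insert e S' :=
      ⟨S.erase e, Finset.notMem_erase e S, (Finset.insert_erase he).symm⟩
    have hc := Finset.card_insert_of_notMem he'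
    obtain ⟨σ', hσ', hcount, hcross⟩ := h.exists_delete_of_not_sameCycle he' hs
    obtain ⟨T, j, hT, hX, hsp, hj⟩ := ih _ (by omega) hσ' rfl
    refine ⟨T, j + 1, hT.trans (Reduces.insert he'), fun X hSX => hX X (hcross X hSX), hsp, ?_⟩
    rw [hc]
    rw [hcount] at hj
    push_cast at hj ⊢
    linarith
  push Not at hex
  -- Every edge now has the same face on both sides. Among all edges, `e` has its two darts closest
  -- along a face, so no other edge has both darts strictly between them.
  obtain ⟨e, he, s, k, hk, hkd, hmin⟩ := IsRotation.exists_minimal_dart hS hex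
  obtain ⟨S', he', rfl⟩ : ∃ S', e ∉ S' ∧ S = insert e S' :=
    ⟨S.erase e, Finset.notMem_erase e S, (Finset.insert_erase he).symm⟩
  have hc := Finset.card_insert_of_notMem he'
  have hdd := hex e he s
  have hdne : (Sum.inl (e, s) : Dart E V) ≠ Sum.inl (e, !s) := by simp
  have hdm : (Sum.inl (e, s) : Dart E V) ∈ darts (insert e S') Set.univ := he
  have hdm' : (Sum.inl (e, !s) : Dart E V) ∈ darts (insert e S') Set.univ := he
  have hφd : facePerm σ (insert e S') (Sum.inl (e, s)) = σ (Sum.inl (e, !s)) := by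
    rw [facePerm, mul_apply, flip_inl_of_mem he]
  have hφd' : facePerm σ (insert e S') (Sum.inl (e, !s)) = σ (Sum.inl (e, s)) := by
    rw [facePerm, mul_apply, flip_inl_of_mem he, Bool.not_not]
  have hne : σ (Sum.inl (e, s)) ≠ Sum.inl (e, !s) := fun h' =>
    hdne (hdd.symm.eq_of_left (hφd'.trans h')).symm
  have hne' : σ (Sum.inl (e, !s)) ≠ Sum.inl (e, s) := fun h' =>
    hdne (hdd.eq_of_left (hφd.trans h'))
  obtain ⟨σ', a, b, hσ', ha, hb, hva, hvb, hσ, haσ, hbσ⟩ := h.delete_edge he' hne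
  replace hbσ := hbσ hne'
  have hab : ¬ SameCycle (facePerm σ' S') a b := fun hab =>
    (hσ'.facePerm_insert_of_sameCycle he' ha hb hab hσ).2.2 hdd
  obtain ⟨hcount, -, horb⟩ := hσ'.facePerm_insert_of_not_sameCycle he' ha hb hab hσ
  have hφφ : facePerm σ (insert e S') = swap (Sum.inl (e, s)) a * (swap (Sum.inl (e, !s)) b *
      (swap (Sum.inl (e, s)) (Sum.inl (e, !s)) * facePerm σ' S')) := by
    rw [hσ, facePerm, face_insert (hσ'.apply_inl he') he']
    rfl
  have hfix := hσ'.facePerm_inl he'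
  have had := ne_inl_of_mem_darts he' ha
  have hbd := ne_inl_of_mem_darts he' hb
  have hpm := h.facePerm_pow_mem hdm
  set φ := facePerm σ (insert e S') with hφ
  set φ' := facePerm σ' S' with hφ'
  set d : Dart E V := Sum.inl (e, s) with hd
  set d' : Dart E V := Sum.inl (e, !s) with hd'
  have hk1 : 1 < k := by
    by_contra hk'
    obtain rfl : k = 1 := by omega
    rw [pow_one, hφd, ← hbσ] at hkd
    exact hbd _ hkd
  have hm1 : ∀ i, 0 < i → i < k → (φ ^ i) d ≠ d' := fun i hi hik => hmin e he s i hi hik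
  have hm2 : ∀ i, 0 < i → i < k → (φ ^ i) d ≠ d := by
    intro i hi hik h'
    refine hm1 (k - i) (by omega) (by omega) ?_
    rw [← hkd]
    nth_rw 1 [← h']
    rw [← mul_apply, ← pow_add]
    congr 2
    omega
  -- Deleting `e` cuts its face in two; the darts strictly between `d` and `d'` are closed under the
  -- new face permutation and contain `b`.
  have hclosed : ∀ x ∈ {x | ∃ i, 0 < i ∧ i < k ∧ (φ ^ i) d = x},
      φ' x ∈ {x | ∃ i, 0 < i ∧ i < k ∧ (φ ^ i) d = x} := by
    rintro x ⟨i, hi, hik, rfl⟩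
    have hstep : φ ((φ ^ i) d) = (φ ^ (i + 1)) d := by rw [pow_succ', mul_apply]
    have hyd : φ' ((φ ^ i) d) ≠ d := fun h' =>
      hm2 i hi hik (φ'.injective (h'.trans (hfix s).symm))
    have hyd' : φ' ((φ ^ i) d) ≠ d' := fun h' =>
      hm1 i hi hik (φ'.injective (h'.trans (hfix _).symm))
    have happ : φ ((φ ^ i) d) = swap d a (swap d' b (swap d d' (φ' ((φ ^ i) d)))) :=
      DFunLike.congr_fun hφφ _
    rw [swap_apply_of_ne_of_ne hyd hyd'] at happ
    by_cases hyb : φ' ((φ ^ i) d) = b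
    · rw [hyb]
      exact ⟨1, one_pos, hk1, by rw [pow_one, hφd, hbσ]⟩
    rw [swap_apply_of_ne_of_ne hyd' hyb] at happ
    by_cases hya : φ' ((φ ^ i) d) = a
    · rw [hya, swap_apply_right, hstep] at happ
      rcases (show i + 1 < k ∨ i + 1 = k by omega) with hik' | hik'
      · exact absurd happ (hm2 _ (by omega) hik')
      · rw [hik', hkd] at happ
        exact absurd happ hdne.symm
    rw [swap_apply_of_ne_of_ne hyd hya, hstep] at happ
    rcases (show i + 1 < k ∨ i + 1 = k by omega) with hik' | hik'
    · exact ⟨i + 1, by omega, hik', happ⟩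
    · rw [hik', hkd] at happ
      exact absurd happ.symm hyd'
  -- If another edge has a dart on this segment, the first such edge `g` forms a removable pair with
  -- `e`. If none has, `e` is pendant.
  by_cases hg : ∃ i, 0 < i ∧ i < k ∧ ∃ g ∈ S', ∃ t, (φ ^ i) d = Sum.inl (g, t)
  · classical
    obtain ⟨hi, hik, g, hgS, t, hgt⟩ := Nat.find_spec hg
    have hfirst := fun m (hm : m < Nat.find hg) => Nat.find_min hg hm
    set i := Nat.find hg
    -- Before `g` the segment consists of half-edges, at which the face permutation stays at the
    -- same vertex; so `g` is incident with the end of `e`.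
    have hvg : ∀ m, 0 < m → m ≤ i → vert en ((φ ^ m) d) = en (e, !s) := by
      intro m hm
      induction m, hm using Nat.le_induction with
      | base =>
        intro _
        rw [pow_one, h.vert_facePerm hdm, hd, flip_inl_of_mem he, vert_inl]
      | succ m hm ihm =>
        intro hmi
        rw [pow_succ', mul_apply, h.vert_facePerm (hpm m), ← ihm (by omega)]
        have hnot := hfirst m (by omega)
        rcases hx : (φ ^ m) d with ⟨f, u⟩ | x
        · exfalso
          have hfm := hpm m
          rw [hx, inl_mem_darts, Finset.mem_insert] at hfm
          rcases hfm with hfe | hfS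
          · obtain rfl : f = e := hfe
            rcases Bool.eq_or_eq_not u s with rfl | rfl
            · exact hm2 m hm (by omega) hx
            · exact hm1 m hm (by omega) hx
          · exact hnot ⟨hm, by omega, f, hfS, u, hx⟩
        · rfl
    have hgv : en (g, t) = en (e, !s) := by
      rw [← hvg i hi le_rfl, hgt, vert_inl]
    have hgS' : g ∈ insert e S' := Finset.mem_insert_of_mem hgS
    -- By the minimality of `k` the reverse of `g` lies off the segment. So once `e` is gone, `g`
    -- separates two faces, and its deletion merges them again.
    have hgP : (Sum.inl (g, !t) : Dart E V) ∉ {x | ∃ i, 0 < i ∧ i < k ∧ (φ ^ i) d = x} := by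
      rintro ⟨m, hm, hmk, hgm⟩
      rcases lt_trichotomy i m with him | him | him
      · refine hmin g hgS' t (m - i) (by omega) (by omega) ?_
        rw [← hgt, ← hgm, ← mul_apply, ← pow_add]
        congr 2
        omega
      · rw [← him, hgt] at hgm
        simp at hgm
      · refine hmin g hgS' (!t) (i - m) (by omega) (by omega) ?_
        rw [Bool.not_not, ← hgt, ← hgm, ← mul_apply, ← pow_add]
        congr 2
        omega
    have hgg : ¬ SameCycle φ' (Sum.inl (g, t)) (Sum.inl (g, !t)) := fun h' =>
      hgP (h'.mem_of_forall_mem hclosed ⟨i, hi, hik, hgt⟩)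
    have hbg : ¬ SameCycle φ' b (Sum.inl (g, !t)) := fun h' =>
      hgP (h'.mem_of_forall_mem hclosed ⟨1, one_pos, hk1, by rw [pow_one, hφd, hbσ]⟩)
    have hge : g ≠ e := by
      rintro rfl
      exact he' hgS
    have hag : SameCycle φ' a (Sum.inl (g, !t)) := by
      have h1 : SameCycle φ d (Sum.inl (g, t)) := ⟨i, by rw [zpow_natCast, hgt]⟩
      rcases horb _ (h1.trans (hex g hgS' t)) with h2 | h2 | h2 | h2
      · simp [hd, hge] at h2
      · simp [hd', hge] at h2
      · exact h2
      · exact absurd h2 hbg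
    -- Without `e` its ends stay connected: `g` starts at one of them, and its other dart shares a
    -- face with the corner `a` at the other.
    have hcross : ∀ X, Crosses en (insert e S') X → Crosses en S' X := by
      rintro X ⟨f, hf, u, hu, hu'⟩
      by_contra hX
      rcases Finset.mem_insert.1 hf with rfl | hf
      · have h1 := hσ'.vert_mem_iff hX ha hag
        rw [hva, vert_inl] at h1
        have h2 : en (g, t) ∈ X ↔ en (g, !t) ∈ X := by
          by_contra hcon
          apply hX
          by_cases ht : en (g, t) ∈ X
          · exact ⟨g, hgS, t, ht, by tauto⟩
          · exact ⟨g, hgS, !t, by tauto, by simpa using ht⟩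
        rw [hgv, h1] at h2
        rcases Bool.eq_or_eq_not u s with rfl | rfl
        · tauto
        · rw [Bool.not_not] at hu'
          tauto
      · exact hX ⟨f, hf, u, hu, hu'⟩
    obtain ⟨S'', hg'', rfl⟩ : ∃ S'', g ∉ S'' ∧ S' = insert g S'' :=
      ⟨S'.erase g, Finset.notMem_erase g S', (Finset.insert_erase hgS).symm⟩
    have hc' := Finset.card_insert_of_notMem hg''
    obtain ⟨σ'', hσ'', hcount', hcross'⟩ := hσ'.exists_delete_of_not_sameCycle hg'' hgg
    obtain ⟨T, j, hT, hX, hsp, hj⟩ := ih _ (by omega) hσ'' rfl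
    have hes : e ∉ S'' := fun h' => he' (Finset.mem_insert_of_mem h')
    refine ⟨T, j, ?_, fun X hSX => hX X (hcross' X (hcross X hSX)), hsp, ?_⟩
    · have := hT.trans (Reduces.insert_insert hg'' hes hge hgv)
      rwa [add_zero] at this
    · rw [hc, hc']
      rw [hcount', ← hφ', ← hcount] at hj
      push_cast at hj ⊢
      linarith
  · have hphantom : ∀ m, 0 < m → m < k → ∃ x, (φ ^ m) d = Sum.inr x := by
      intro m hm hmk
      rcases hx : (φ ^ m) d with ⟨f, u⟩ | x
      · exfalso
        have hfm := hpm m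
        rw [hx, inl_mem_darts, Finset.mem_insert] at hfm
        rcases hfm with hfe | hfS
        · obtain rfl : f = e := hfe
          rcases Bool.eq_or_eq_not u s with rfl | rfl
          · exact hm2 m hm hmk hx
          · exact hm1 m hm hmk hx
        · exact hg ⟨m, hm, hmk, f, hfS, u, hx⟩
      · exact ⟨x, rfl⟩
    -- With only half-edges on the segment, the rotation at this end of `e` consists of `d'` and the
    -- half-edge, so no other dart is there. The pendant edge goes into the forest.
    have hσd' : σ d' = Sum.inr (en (e, !s)) := by
      obtain ⟨x, hx⟩ := hphantom 1 one_pos hk1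
      rw [pow_one, hφd] at hx
      have := h.vert_apply hdm'
      rw [hx] at this
      rw [hx]
      exact congrArg Sum.inr this
    have hσw : σ (Sum.inr (en (e, !s))) = d' ∨
        σ (Sum.inr (en (e, !s))) = Sum.inr (en (e, !s)) := by
      have h2 : (φ ^ 2) d = σ (Sum.inr (en (e, !s))) := by
        rw [pow_succ', pow_one, mul_apply, hφd, hσd', hφ, facePerm, mul_apply, flip_inr]
      rcases (show k = 2 ∨ 2 < k by omega) with rfl | hk2
      · left
        rw [← h2, hkd]
      · right
        obtain ⟨x, hx⟩ := hphantom 2 two_pos hk2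
        have := h.vert_apply (d := Sum.inr (en (e, !s))) (by simp)
        rw [← h2, hx] at this
        rw [← h2, hx]
        exact congrArg Sum.inr this
    have hiso : ∀ f ∈ insert e S', ∀ u, en (f, u) = en (e, !s) → f = e ∧ u = !s := by
      intro f hf u hfu
      have h1 : SameCycle σ d' (Sum.inl (f, u)) :=
        (h.sameCycle_iff _ hdm' (Sum.inl (f, u)) hf).2 hfu.symm
      have h2 := h1.mem_of_forall_mem (P := {d', Sum.inr (en (e, !s))}) (by
        rintro x (rfl | rfl)
        · right; exact hσd'
        · exact hσw) (by simp)
      simpa [hd'] using h2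
    obtain ⟨T, j, hT, hX, hsp, hj⟩ := ih _ (by omega) hσ' rfl
    have heT : e ∉ T := fun h' => he' (hT.subset h')
    refine ⟨insert e T, j, hT.insert_both he', ?_, ?_, ?_⟩
    · rintro X ⟨f, hf, u, hu⟩
      rcases Finset.mem_insert.1 hf with rfl | hf
      · exact ⟨f, Finset.mem_insert_self _ _, u, hu⟩
      · exact (hX X ⟨f, hf, u, hu⟩).mono (Finset.subset_insert _ _)
    · refine hsp.insert (s := !s) (fun h' => ?_) fun f hf u hfu => ?_
      · rw [Bool.not_not] at h'
        have := (hiso e he s h'.symm).2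
        simp at this
      · obtain ⟨rfl, -⟩ := hiso f (Finset.mem_insert_of_mem (hT.subset hf)) u hfu
        exact heT hf
    · rw [hc, Finset.card_insert_of_notMem heT]
      rw [← hφ', ← hcount] at hj
      push_cast at hj ⊢
      linarith

end RotationSystem

/-! ### Trees, and two trees joined by the edges of a cut -/

namespace RotationSystem

open Equiv Equiv.Perm

variable {E V : Type*} [Finite E] [Finite V] [DecidableEq E] [DecidableEq V]
  {en : E × Bool → V}

/-- `T` is the edge set of a tree with vertex set `A`. -/
inductive IsTree (en : E × Bool → V) : Finset V → Finset E → Prop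
  | single (x : V) : IsTree en {x} ∅
  | insert {A : Finset V} {T : Finset E} {e : E} {s : Bool} (h : IsTree en A T)
      (hs : en (e, s) ∉ A) (hs' : en (e, !s) ∈ A) :
      IsTree en (insert (en (e, s)) A) (insert e T)

namespace IsTree

variable {A B : Finset V} {T : Finset E}

theorem mem (h : IsTree en A T) : ∀ e ∈ T, ∀ s, en (e, s) ∈ A := by
  induction h with
  | single x => simp
  | @insert A T e s h hs hs' ih =>
    intro f hf t
    rcases Finset.mem_insert.1 hf with rfl | hf
    · rcases Bool.eq_or_eq_not t s with rfl | rfl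
      · exact Finset.mem_insert_self _ _
      · exact Finset.mem_insert_of_mem hs'
    · exact Finset.mem_insert_of_mem (ih f hf t)

theorem card (h : IsTree en A T) : T.card + 1 = A.card := by
  induction h with
  | single x => simp
  | @insert A T e s h hs hs' ih =>
    rw [Finset.card_insert_of_notMem hs, Finset.card_insert_of_notMem, ih]
    exact fun he => hs (h.mem e he s)

/-- Without edges every vertex is a face, and each tree edge is pendant when it is added, so it
merges two faces. -/
theorem faceBound (h : IsTree en A T) {F : ℤ} (hF : F + T.card = Nat.card V) :
    FaceBound en T F := by
  induction h generalizing F with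
  | single x =>
    obtain rfl : F = Nat.card V := by simpa using hF
    exact FaceBound.empty
  | @insert A T e s h hs hs' ih =>
    have he : e ∉ T := fun he => hs (h.mem e he s)
    rw [Finset.card_insert_of_notMem he] at hF
    push_cast at hF
    exact (ih (by linarith)).insert_pendant he (s := s) (fun h' => hs (h' ▸ hs'))
      fun f hf t hft => hs (hft ▸ h.mem f hf t)

/-- A connected multigraph has a spanning tree. -/
theorem exists_of_crosses {S : Finset E} (hA : A.Nonempty) (hS : ∀ e ∈ S, ∀ s, en (e, s) ∈ A)
    (h : ∀ B ⊂ A, B.Nonempty → Crosses en S (B : Set V)) : ∃ T ⊆ S, IsTree en A T := by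
  have key : ∀ n, 1 ≤ n → n ≤ A.card → ∃ B ⊆ A, ∃ T ⊆ S, IsTree en B T ∧ B.card = n := by
    intro n hn
    induction n, hn using Nat.le_induction with
    | base =>
      intro _
      obtain ⟨x, hx⟩ := hA
      exact ⟨{x}, by simpa using hx, ∅, by simp, single x, by simp⟩
    | succ n hn ih =>
      intro hnA
      obtain ⟨B, hB, T, hT, hBT, rfl⟩ := ih (by omega)
      have hBA : B ⊂ A := by
        refine hB.ssubset_of_ne ?_
        rintro rfl
        omega
      obtain ⟨e, he, s, hs, hs'⟩ := h B hBA (Finset.card_pos.1 hn)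
      refine ⟨Insert.insert (en (e, !s)) B, Finset.insert_subset (hS e he _) hB,
        Insert.insert e T, Finset.insert_subset he hT, hBT.insert (by simpa using hs')
          (by simpa using hs), Finset.card_insert_of_notMem (by simpa using hs')⟩
  obtain ⟨B, hB, T, hT, hBT, hc⟩ := key _ hA.card_pos le_rfl
  obtain rfl := Finset.eq_of_subset_of_card_le hB hc.ge
  exact ⟨T, hT, hBT⟩

/-- A connected forest is a tree. -/
theorem of_sparse (hA : A.Nonempty) (hT : ∀ e ∈ T, ∀ s, en (e, s) ∈ A)
    (h : ∀ B ⊂ A, B.Nonempty → Crosses en T (B : Set V)) (hsp : Sparse en T) :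
    IsTree en A T := by
  obtain ⟨T', hT', htree⟩ := exists_of_crosses hA hT h
  have h1 := hsp A hA
  rw [Finset.filter_true_of_mem hT] at h1
  obtain rfl := Finset.eq_of_subset_of_card_le hT' (by have := htree.card; omega)
  exact htree

end IsTree

/-- Removing an adjacent pair preserves the parity of |D| - 1, and restoring it costs no face. If
the pair is all of `D`, only `e` is removed: the bound for one edge is smaller by one, which pays
for restoring `e`. -/
theorem faceBound_of_adjacent {U D : Finset E} (hUD : Disjoint U D) {K : ℤ}
    (ih : ∀ D' ⊂ D, D'.Nonempty → ∀ F : ℤ, F + K = ((D'.card - 1) % 2 : ℕ) →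
      FaceBound en (U ∪ D') F)
    {e f : E} (he : e ∈ D) (hf : f ∈ D) (hef : e ≠ f) {s t : Bool}
    (hst : en (e, s) = en (f, t)) {F : ℤ} (hF : F + K = ((D.card - 1) % 2 : ℕ)) :
    FaceBound en (U ∪ D) F := by
  obtain ⟨D₁, he₁, rfl⟩ : ∃ D₁, e ∉ D₁ ∧ D = insert e D₁ :=
    ⟨D.erase e, Finset.notMem_erase e D, (Finset.insert_erase he).symm⟩
  have hf₁ : f ∈ D₁ := by simpa [hef.symm] using hf
  obtain ⟨D₂, hf₂, rfl⟩ : ∃ D₂, f ∉ D₂ ∧ D₁ = insert f D₂ :=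
    ⟨D₁.erase f, Finset.notMem_erase f D₁, (Finset.insert_erase hf₁).symm⟩
  have he₂ : e ∉ D₂ := fun h => he₁ (Finset.mem_insert_of_mem h)
  rw [Finset.disjoint_insert_right, Finset.disjoint_insert_right] at hUD
  rw [Finset.card_insert_of_notMem he₁, Finset.card_insert_of_notMem hf₂] at hF
  rcases D₂.eq_empty_or_nonempty with rfl | hD₂
  · have h1 := ih (insert f ∅) (Finset.ssubset_insert he₁) ⟨f, by simp⟩ (F - 1) (by
      simp at hF ⊢
      linarith)
    have h2 := h1.insert (e := e) (by simp [hUD, hef])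
    rwa [sub_add_cancel, ← Finset.union_insert] at h2
  · have h1 := ih D₂ ((Finset.ssubset_insert hf₂).trans (Finset.ssubset_insert he₁)) hD₂ F (by
      have := hD₂.card_pos
      rw [hF]
      congr 1
      omega)
    have h2 := h1.insert_insert (e := f) (f := e) (by simp [hUD, hf₂]) (by simp [hUD, he₂])
      hef.symm hst.symm
    rwa [← Finset.union_insert, ← Finset.union_insert] at h2

/-- Two disjoint trees and the edges `D` between them form a multigraph with at most two faces. -/
theorem IsTree.faceBound_union {A B : Finset V} {T U D : Finset E} (hA : IsTree en A T)
    (hB : IsTree en B U) (hAB : Disjoint A B)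
    (hD : ∀ e ∈ D, ∃ s, en (e, s) ∈ A ∧ en (e, !s) ∈ B) (hne : D.Nonempty) {F : ℤ}
    (hF : F + (T.card + U.card + 1 - Nat.card V) = ((D.card - 1) % 2 : ℕ)) :
    FaceBound en (T ∪ U ∪ D) F := by
  induction hA generalizing B U D F with
  | single x =>
    rw [Finset.disjoint_singleton_left] at hAB
    simp only [Finset.mem_singleton] at hD
    -- All edges of `D` meet at `x`, so any two are adjacent; the last one is pendant at `x`.
    induction D using Finset.strongInduction generalizing F with
    | H D ih =>
    rw [Finset.empty_union]
    have hUD : Disjoint U D := by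
      rw [Finset.disjoint_left]
      intro e heU heD
      obtain ⟨s, hs, -⟩ := hD e heD
      exact hAB (hs ▸ hB.mem e heU s)
    by_cases hc : D.card = 1
    · obtain ⟨f, rfl⟩ := Finset.card_eq_one.1 hc
      obtain ⟨s, hs, hs'⟩ := hD f (Finset.mem_singleton_self f)
      have hf : f ∉ U := by simpa using hUD
      have h1 : FaceBound en U (F + 1) := hB.faceBound (by simp at hF; linarith)
      have h2 := h1.insert_pendant hf (s := s) (fun h => hAB (by rwa [← hs, h]))
        fun g hg t hgt => hAB (by rw [← hs, ← hgt]; exact hB.mem g hg t)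
      rwa [Finset.union_singleton]
    · obtain ⟨e, he, f, hf, hef⟩ := Finset.one_lt_card.1
        (show 1 < D.card by have := hne.card_pos; omega)
      obtain ⟨s, hs, -⟩ := hD e he
      obtain ⟨t, ht, -⟩ := hD f hf
      refine faceBound_of_adjacent hUD (fun D' hD' hne' F' hF' => ?_) he hf hef
        (hs.trans ht.symm) hF
      have := ih D' hD' hne' hF' (fun g hg => hD g (hD'.1 hg))
      rwa [Finset.empty_union] at this
  | @insert A T e₀ s₀ h hs₀ hs₀' ihA =>
    have he₀ : e₀ ∉ T := fun he => hs₀ (h.mem e₀ he s₀)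
    induction D using Finset.strongInduction generalizing F with
    | H D ih =>
    have hdisj := Finset.disjoint_left.1 hAB
    have hxB : en (e₀, s₀) ∉ B := hdisj (Finset.mem_insert_self _ _)
    have htree := h.insert hs₀ hs₀'
    have hTD : ∀ e ∈ Insert.insert e₀ T, e ∉ D := by
      intro e heT heD
      obtain ⟨s, -, hs⟩ := hD e heD
      exact hdisj (htree.mem e heT _) hs
    have hUD : ∀ e ∈ U, e ∉ D := by
      intro e heU heD
      obtain ⟨s, hs, -⟩ := hD e heD
      exact hdisj hs (hB.mem e heU _)
    -- The cases are whether at least two, exactly one or no edges of `D` meet the leaf of the first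
    -- tree.
    by_cases h2 : ∃ e ∈ D, ∃ f ∈ D, e ≠ f ∧ ∃ s t, en (e, s) = en (e₀, s₀) ∧
        en (f, t) = en (e₀, s₀)
    · obtain ⟨e, he, f, hf, hef, s, t, hs, ht⟩ := h2
      refine faceBound_of_adjacent ?_ (fun D' hD' hne' F' hF' =>
        ih D' hD' (fun g hg => hD g (hD'.1 hg)) hne' hF') he hf hef (hs.trans ht.symm) hF
      rw [Finset.disjoint_left]
      intro e he
      rcases Finset.mem_union.1 he with he | he
      · exact hTD e he
      · exact hUD e he
    rw [Finset.card_insert_of_notMem he₀, Nat.cast_add, Nat.cast_one] at hF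
    have he₀U : e₀ ∉ U := fun he => hxB (hB.mem e₀ he s₀)
    have he₀D : e₀ ∉ D := hTD e₀ (Finset.mem_insert_self _ _)
    by_cases h1 : ∃ f ∈ D, ∃ t, en (f, t) = en (e₀, s₀)
    · obtain ⟨f, hf, t, hft⟩ := h1
      have hfB : en (f, !t) ∈ B := by
        obtain ⟨s, hs, hs'⟩ := hD f hf
        rcases Bool.eq_or_eq_not s t with rfl | rfl
        · exact hs'
        · rw [Bool.not_not, hft] at hs'
          exact absurd hs' hxB
      have hfU : f ∉ U := fun h => hUD f h hf
      -- The leaf moves from the first tree to the second: `f` becomes a tree edge and `e₀` replaces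
      -- it in the cut. The union of all edges and the size of the cut are unchanged, while the
      -- first tree shrinks.
      have hB' := hB.insert (e := f) (s := t) (by rwa [hft]) hfB
      have hc : (Insert.insert e₀ (D.erase f)).card = D.card := by
        rw [Finset.card_insert_of_notMem (fun h => he₀D (Finset.mem_of_mem_erase h)),
          Finset.card_erase_of_mem hf]
        have := hne.card_pos
        omega
      have := ihA (F := F) hB' (D := Insert.insert e₀ (D.erase f)) ?_ ?_ ⟨e₀, by simp⟩ ?_
      · convert! this using 1
        ext g
        by_cases hgf : g = f
        · simp [hgf, hf]
        · simp only [Finset.mem_union, Finset.mem_insert, Finset.mem_erase, hgf]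
          tauto
      · rw [hft, Finset.disjoint_insert_right]
        exact ⟨hs₀, hAB.mono_left (Finset.subset_insert _ _)⟩
      · intro g hg
        rcases Finset.mem_insert.1 hg with rfl | hg
        · refine ⟨!s₀, hs₀', ?_⟩
          rw [Bool.not_not, hft]
          exact Finset.mem_insert_self _ _
        · obtain ⟨hgf, hgD⟩ := Finset.mem_erase.1 hg
          obtain ⟨s, hs, hs'⟩ := hD g hgD
          rcases Finset.mem_insert.1 hs with hs | hs
          · exact absurd ⟨g, hgD, f, hf, hgf, s, t, hs, hft⟩ h2
          · exact ⟨s, hs, Finset.mem_insert_of_mem hs'⟩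
      · rw [Finset.card_insert_of_notMem hfU, hc, ← hF]
        push_cast
        ring
    · push Not at h1
      have hD' : ∀ e ∈ D, ∃ s, en (e, s) ∈ A ∧ en (e, !s) ∈ B := by
        intro e he
        obtain ⟨s, hs, hs'⟩ := hD e he
        exact ⟨s, Finset.mem_of_mem_insert_of_ne hs (h1 e he s), hs'⟩
      have h3 := ihA (F := F + 1) hB (hAB.mono_left (Finset.subset_insert _ _)) hD' hne
        (by rw [← hF]; ring)
      rw [Finset.insert_union, Finset.insert_union]
      refine h3.insert_pendant (by simp [he₀, he₀U, he₀D]) (s := s₀)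
        (fun h' => hs₀ (h' ▸ hs₀')) fun f hf t hft => ?_
      rcases Finset.mem_union.1 hf with hf | hf
      · rcases Finset.mem_union.1 hf with hf | hf
        · exact hs₀ (hft ▸ h.mem f hf t)
        · exact hxB (hft ▸ hB.mem f hf t)
      · exact h1 f hf t hft

end RotationSystem

/-! ### Rotation and reversal on the positive flags of an oriented embedding -/

namespace Graph.CellularEmbedding

open Equiv Equiv.Perm

variable {α : Type u} {β : Type v} {G : Graph α β} {Φ : Type w} (M : G.CellularEmbedding Φ)

theorem vert_τ₁ (x : Φ) : M.vert (M.τ₁ x) = M.vert x :=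
  ((M.vert_eq_iff _ _).2 (.rel _ _ (Or.inl rfl))).symm

theorem vert_τ₂ (x : Φ) : M.vert (M.τ₂ x) = M.vert x :=
  ((M.vert_eq_iff _ _).2 (.rel _ _ (Or.inr rfl))).symm

theorem edge_τ₀ (x : Φ) : M.edge (M.τ₀ x) = M.edge x :=
  ((M.edge_eq_iff x (M.τ₀ x)).2 (Or.inr (Or.inl rfl))).symm

include M in
theorem finite_flags (hE : G.edgeSet.Finite) : Finite Φ := by
  have h : (⋃ e ∈ G.edgeSet, {x | M.edge x = e}).Finite := by
    refine hE.biUnion fun e _ => ?_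
    by_cases hx : ∃ x, M.edge x = e
    · obtain ⟨x, rfl⟩ := hx
      refine (Set.toFinite {x, M.τ₀ x, M.τ₂ x, M.τ₀ (M.τ₂ x)}).subset fun y hy => ?_
      exact (M.edge_eq_iff x y).1 hy.symm
    · convert Set.finite_empty
      ext x
      simp only [Set.mem_ofPred_eq, Set.mem_empty_iff_false, iff_false]
      exact fun h => hx ⟨x, h⟩
  refine Set.finite_univ_iff.1 (h.subset fun x _ => ?_)
  exact Set.mem_biUnion (M.isLink x).edge_mem rfl

section Oriented

variable {c : Φ → Bool} (hc : ∀ x, c (M.τ₀ x) ≠ c x ∧ c (M.τ₁ x) ≠ c x ∧ c (M.τ₂ x) ≠ c x)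

include hc

theorem orient_τ₀ (x : Φ) : c (M.τ₀ x) = !c x := Bool.eq_not.2 (hc x).1

theorem orient_τ₁ (x : Φ) : c (M.τ₁ x) = !c x := Bool.eq_not.2 (hc x).2.1

theorem orient_τ₂ (x : Φ) : c (M.τ₂ x) = !c x := Bool.eq_not.2 (hc x).2.2

/-- The rotation of the positive flags about their vertices. -/
def rotation : Perm {x // c x = true} where
  toFun x := ⟨M.τ₁ (M.τ₂ x.1), by simp [M.orient_τ₁ hc, M.orient_τ₂ hc, x.2]⟩
  invFun x := ⟨M.τ₂ (M.τ₁ x.1), by simp [M.orient_τ₁ hc, M.orient_τ₂ hc, x.2]⟩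
  left_inv x := Subtype.ext (by simp [M.τ₁_τ₁, M.τ₂_τ₂])
  right_inv x := Subtype.ext (by simp [M.τ₁_τ₁, M.τ₂_τ₂])

/-- The involution that exchanges the two positive flags of an edge. -/
def reversal : Perm {x // c x = true} where
  toFun x := ⟨M.τ₀ (M.τ₂ x.1), by simp [M.orient_τ₀ hc, M.orient_τ₂ hc, x.2]⟩
  invFun x := ⟨M.τ₀ (M.τ₂ x.1), by simp [M.orient_τ₀ hc, M.orient_τ₂ hc, x.2]⟩
  left_inv x := Subtype.ext (by simp [M.τ₀_τ₂, M.τ₀_τ₀, M.τ₂_τ₂])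
  right_inv x := Subtype.ext (by simp [M.τ₀_τ₂, M.τ₀_τ₀, M.τ₂_τ₂])

/-- Each pair of flags exchanged by `τ₂` contains exactly one positive flag. On these
representatives a step by `τ₁` is a step of the rotation, forwards or backwards. -/
theorem sameCycle_rotation_iff [Finite Φ] (x y : {x // c x = true}) :
    SameCycle (M.rotation hc) x y ↔ M.vert x.1 = M.vert y.1 := by
  constructor
  · intro h
    refine (h.mem_of_forall_mem (P := {z | M.vert z.1 = M.vert x.1}) (fun z hz => ?_) (by simp)).symm
    exact (M.vert_τ₁ _).trans ((M.vert_τ₂ _).trans hz)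
  · rw [M.vert_eq_iff]
    have key : ∀ {a b : Φ}, Relation.EqvGen (fun a b => b = M.τ₁ a ∨ b = M.τ₂ a) a b →
        ∀ p q : {x // c x = true}, (p.1 = a ∨ p.1 = M.τ₂ a) → (q.1 = b ∨ q.1 = M.τ₂ b) →
          SameCycle (M.rotation hc) p q := by
      have huniq : ∀ (a : Φ) (p q : {x // c x = true}), (p.1 = a ∨ p.1 = M.τ₂ a) →
          (q.1 = a ∨ q.1 = M.τ₂ a) → p = q := by
        intro a p q hp hq
        have h1 := p.2
        have h2 := q.2
        have h3 := M.orient_τ₂ hc a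
        apply Subtype.ext
        rcases hp with hp | hp <;> rcases hq with hq | hq
        · rw [hp, hq]
        · rw [hp] at h1; rw [hq, h3, h1] at h2; simp at h2
        · rw [hq] at h2; rw [hp, h3, h2] at h1; simp at h1
        · rw [hp, hq]
      intro a b h
      induction h with
      | rel a b hab =>
        intro p q hp hq
        rcases hab with rfl | rfl
        · rcases hp with hp | hp
          · have : M.rotation hc q = p := by
              refine Subtype.ext ?_
              have hq' : q.1 = M.τ₂ (M.τ₁ a) := by
                rcases hq with hq | hq
                · have h1 := q.2
                  have h2 := p.2
                  rw [hq, M.orient_τ₁ hc, ← hp, h2] at h1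
                  simp at h1
                · exact hq
              change M.τ₁ (M.τ₂ q.1) = p.1
              rw [hq', M.τ₂_τ₂, M.τ₁_τ₁, hp]
            rw [← this]
            exact sameCycle_apply_left.2 (SameCycle.refl _ _)
          · have : M.rotation hc p = q := by
              refine Subtype.ext ?_
              have hq' : q.1 = M.τ₁ a := by
                rcases hq with hq | hq
                · exact hq
                · have h1 := q.2
                  have h2 := p.2
                  rw [hp, M.orient_τ₂ hc] at h2
                  rw [hq, M.orient_τ₂ hc, M.orient_τ₁ hc] at h1
                  rw [← h2] at h1
                  simp at h1
              change M.τ₁ (M.τ₂ p.1) = q.1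
              rw [hq', hp, M.τ₂_τ₂]
            rw [← this]
            exact sameCycle_apply_right.2 (SameCycle.refl _ _)
        · rw [M.τ₂_τ₂] at hq
          rw [huniq a p q hp hq.symm]
      | refl a =>
        intro p q hp hq
        rw [huniq a p q hp hq]
      | symm a b _ ih => exact fun p q hp hq => (ih q p hq hp).symm
      | trans a b d _ _ ih1 ih2 =>
        intro p q hp hq
        obtain ⟨r, hr⟩ : ∃ r : {x // c x = true}, r.1 = b ∨ r.1 = M.τ₂ b := by
          by_cases hb : c b = true
          · exact ⟨⟨b, hb⟩, Or.inl rfl⟩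
          · exact ⟨⟨M.τ₂ b, by rw [M.orient_τ₂ hc]; simpa using hb⟩, Or.inr rfl⟩
        exact (ih1 p r hp hr).trans (ih2 r q hr hq)
    exact fun h => key h x y (Or.inl rfl) (Or.inl rfl)

/-- On positive flags the product is `τ₁ ∘ τ₀`, and each pair exchanged by `τ₀` has exactly one
positive flag. The condition `hiso` excludes the faces that have no flags. -/
theorem card_face [Finite Φ] (hiso : ∀ a ∈ G.vertexSet, ∃ e, G.Inc e a) :
    Nat.card M.Face = (M.rotation hc * M.reversal hc).orbitCount := by
  have hempty : IsEmpty {a : α // a ∈ G.vertexSet ∧ ∀ e, ¬ G.Inc e a} :=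
    ⟨fun ⟨a, ha, h⟩ => by obtain ⟨e, he⟩ := hiso a ha; exact h e he⟩
  have happ : ∀ x : {x // c x = true}, ((M.rotation hc * M.reversal hc) x).1 =
      M.τ₁ (M.τ₀ x.1) := by
    intro x
    change M.τ₁ (M.τ₂ (M.τ₀ (M.τ₂ x.1))) = _
    rw [M.τ₀_τ₂, M.τ₂_τ₂]
  set φ := M.rotation hc * M.reversal hc
  let r : Φ → Φ → Prop := fun x y => y = M.τ₀ x ∨ y = M.τ₁ x
  have hfwd : ∀ x y : {x // c x = true}, SameCycle φ x y → Quot.mk r x.1 = Quot.mk r y.1 := by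
    intro x y h
    refine (h.mem_of_forall_mem (P := {z | Quot.mk r x.1 = Quot.mk r z.1}) (fun z hz => ?_) (by simp))
    have h1 : Quot.mk r z.1 = Quot.mk r (M.τ₀ z.1) := Quot.sound (Or.inl rfl)
    have h2 : Quot.mk r (M.τ₀ z.1) = Quot.mk r (M.τ₁ (M.τ₀ z.1)) := Quot.sound (Or.inr rfl)
    rw [Set.mem_ofPred_eq, happ, ← h2, ← h1]
    exact hz
  let f : Quotient (SameCycle.setoid φ) → Quot r := Quotient.lift (fun x => Quot.mk r x.1) hfwd
  let pos : Φ → {x // c x = true} := fun a =>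
    if h : c a = true then ⟨a, h⟩ else ⟨M.τ₀ a, by rw [M.orient_τ₀ hc]; simpa using h⟩
  have hpos : ∀ a, c a = true → (pos a).1 = a := fun a h => by simp [pos, h]
  have hneg : ∀ a, c a = false → (pos a).1 = M.τ₀ a := fun a h => by simp [pos, h]
  have hbwd : ∀ a b, r a b → SameCycle φ (pos a) (pos b) := by
    rintro a b (rfl | rfl)
    · have : pos a = pos (M.τ₀ a) := by
        apply Subtype.ext
        cases h : c a
        · rw [hneg a h, hpos _ (by rw [M.orient_τ₀ hc, h]; rfl)]
        · rw [hpos a h, hneg _ (by rw [M.orient_τ₀ hc, h]; rfl), M.τ₀_τ₀]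
      rw [this]
    · cases h : c a
      · have : φ (pos a) = pos (M.τ₁ a) := by
          apply Subtype.ext
          rw [happ, hneg a h, hpos _ (by rw [M.orient_τ₁ hc, h]; rfl), M.τ₀_τ₀]
        rw [← this]
        exact sameCycle_apply_right.2 (SameCycle.refl _ _)
      · have : φ (pos (M.τ₁ a)) = pos a := by
          apply Subtype.ext
          rw [happ, hpos a h, hneg _ (by rw [M.orient_τ₁ hc, h]; rfl), M.τ₀_τ₀, M.τ₁_τ₁]
        rw [← this]
        exact sameCycle_apply_left.2 (SameCycle.refl _ _)
  let g : Quot r → Quotient (SameCycle.setoid φ) :=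
    Quot.lift (fun a => Quotient.mk _ (pos a)) fun a b h => Quotient.sound (hbwd a b h)
  have hf : Function.Bijective f := by
    refine Function.bijective_iff_has_inverse.2 ⟨g, fun q => ?_, fun q => ?_⟩
    · induction q using Quotient.inductionOn with | _ x
      exact congrArg (Quotient.mk _) (Subtype.ext (hpos x.1 x.2))
    · induction q using Quot.inductionOn with | _ a
      change Quot.mk r (pos a).1 = Quot.mk r a
      cases h : c a
      · rw [hneg a h]
        exact (Quot.sound (show r a (M.τ₀ a) from Or.inl rfl)).symm
      · rw [hpos a h]
  have h1 : Nat.card M.Face = Nat.card (Quot r) :=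
    Nat.card_congr (Equiv.sumEmpty _ _)
  rw [h1, orbitCount, Nat.card_congr (Equiv.ofBijective f hf)]

end Oriented

end Graph.CellularEmbedding

/-! ### Adding and removing the half-edges -/

namespace RotationSystem

open Equiv Equiv.Perm

variable {E V : Type*} [Finite E] [Finite V] [DecidableEq E] [DecidableEq V]
  {en : E × Bool → V} {S : Finset E} {σ : Perm (Dart E V)}

/-- At a vertex with an edge the half-edge, until then a fixed point, is absorbed into a face. At an
isolated vertex it stays fixed and is itself the face. -/
theorem IsRotation.exists_insert_inr {H : Set V} (h : IsRotation (vert en) (darts S H) σ) {x : V}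
    (hx : x ∉ H) :
    ∃ σ' : Perm (Dart E V), IsRotation (vert en) (darts S (insert x H)) σ' ∧
      ((∃ q : E × Bool, q.1 ∈ S ∧ en q = x) →
        (facePerm σ' S).orbitCount + 1 = (facePerm σ S).orbitCount) ∧
      ((¬ ∃ q : E × Bool, q.1 ∈ S ∧ en q = x) →
        (facePerm σ' S).orbitCount = (facePerm σ S).orbitCount) := by
  have hd : (darts S (insert x H) : Set (Dart E V)) = insert (Sum.inr x) (darts S H) := by
    ext d
    rcases d with q | y <;> simp
  have hfix : σ (Sum.inr x) = Sum.inr x := h.apply_eq _ hx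
  by_cases hq : ∃ q : E × Bool, q.1 ∈ S ∧ en q = x
  · obtain ⟨q, hqS, hqx⟩ := hq
    refine ⟨swap (Sum.inr x) (Sum.inl q) * σ, ?_, fun _ => ?_,
      fun hn => absurd ⟨q, hqS, hqx⟩ hn⟩
    · rw [hd]
      exact h.insert_dart (q := Sum.inr x) (a := Sum.inl q) hx hqS hqx.symm
    · rw [facePerm, mul_assoc]
      refine orbitCount_swap_mul_of_not_sameCycle (not_sameCycle_of_apply_eq ?_ (by simp))
      rw [mul_apply, flip_inr, hfix]
  · refine ⟨σ, ?_, fun h' => absurd h' hq, fun _ => rfl⟩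
    rw [hd]
    have hne : ∀ d ∈ darts S H, vert en d ≠ x := by
      rintro (q | y) hd' rfl
      · exact hq ⟨q, hd', rfl⟩
      · exact hx hd'
    have hne' : ∀ d ∈ darts S H, (Sum.inr x : Dart E V) ≠ d := by
      rintro d hd' rfl
      exact hx hd'
    refine ⟨fun d hd' => h.apply_eq d fun h' => hd' (Or.inr h'), ?_⟩
    rintro d (rfl | hd₁) d' (rfl | hd₂)
    · simp [SameCycle.refl]
    · have := not_sameCycle_of_apply_eq hfix (hne' d' hd₂)
      simp [this, (hne d' hd₂).symm]
    · have : ¬ SameCycle σ d (Sum.inr x) := fun h' =>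
        not_sameCycle_of_apply_eq hfix (hne' d hd₁) h'.symm
      simp [this, hne d hd₁]
    · exact h.sameCycle_iff d hd₁ d' hd₂

/-- A rotation system without half-edges, given on an abstract set of darts, extends to one with
a half-edge at each vertex. -/
theorem exists_isRotation_of_perm {X : Type*} [Finite X] {ρ ι : Perm X} {θ : X → E × Bool}
    (hθ : Function.Injective θ) (hrange : ∀ q, q ∈ Set.range θ ↔ q.1 ∈ S)
    (hρ : ∀ x y, SameCycle ρ x y ↔ en (θ x) = en (θ y))
    (hι : ∀ x, θ (ι x) = ((θ x).1, !(θ x).2)) :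
    ∃ σ : Perm (Dart E V), IsRotation (vert en) (darts S Set.univ) σ ∧
      (facePerm σ S).orbitCount + {x | ∃ q : E × Bool, q.1 ∈ S ∧ en q = x}.ncard + 2 * S.card =
        (ρ * ι).orbitCount + 2 * Nat.card E + Nat.card V := by
  classical
  let f : X ≃ {d : Dart E V // d ∈ darts S ∅} := Equiv.ofBijective
    (fun x => ⟨Sum.inl (θ x), (hrange _).1 ⟨x, rfl⟩⟩) (by
      constructor
      · intro x y hxy
        exact hθ (Sum.inl_injective (congrArg Subtype.val hxy))
      · rintro ⟨q | x, hd⟩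
        · obtain ⟨x, rfl⟩ := (hrange q).2 hd
          exact ⟨x, rfl⟩
        · exact absurd hd (Set.notMem_empty x))
  have hf : ∀ x, (f x : Dart E V) = Sum.inl (θ x) := fun x => rfl
  let σ₀ : Perm (Dart E V) := ρ.extendDomain f
  have happ : ∀ x, σ₀ (Sum.inl (θ x)) = Sum.inl (θ (ρ x)) := fun x =>
    extendDomain_apply_image ρ f x
  have hσ₀ : IsRotation (vert en) (darts S ∅) σ₀ := by
    refine ⟨fun d hd => extendDomain_apply_not_subtype ρ f hd, fun d hd d' hd' => ?_⟩
    obtain ⟨x, hx⟩ := f.surjective ⟨d, hd⟩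
    obtain ⟨y, hy⟩ := f.surjective ⟨d', hd'⟩
    obtain rfl : Sum.inl (θ x) = d := congrArg Subtype.val hx
    obtain rfl : Sum.inl (θ y) = d' := congrArg Subtype.val hy
    rw [vert_inl, vert_inl, ← hρ]
    exact sameCycle_extendDomain (f := f)
  have hinj : Function.Injective (fun x => (Sum.inl (θ x) : Dart E V)) :=
    Sum.inl_injective.comp hθ
  have hcount₀ : (facePerm σ₀ S).orbitCount + 2 * S.card =
      (ρ * ι).orbitCount + 2 * Nat.card E + Nat.card V := by
    have h1 := orbitCount_eq_add_of_semiconj (π := ρ * ι) (ρ := facePerm σ₀ S) hinj ?_ ?_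
    · have h2 := Set.ncard_add_ncard_compl (Set.range fun x => (Sum.inl (θ x) : Dart E V))
      have h3 : (Set.range fun x => (Sum.inl (θ x) : Dart E V)).ncard = 2 * S.card := by
        have : (Set.range fun x => (Sum.inl (θ x) : Dart E V)) =
            Sum.inl '' ((S ×ˢ Finset.univ : Finset (E × Bool)) : Set (E × Bool)) := by
          ext d
          rcases d with q | x
          · simpa using hrange q
          · simp
        rw [this, Set.ncard_image_of_injective _ Sum.inl_injective, Set.ncard_coe_finset,
          Finset.card_product]
        simp [mul_comm]
      rw [Nat.card_sum, Nat.card_prod] at h2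
      simp at h2
      omega
    · intro x
      have hx : (θ x).1 ∈ S := (hrange _).1 ⟨x, rfl⟩
      rw [facePerm, mul_apply, ← Prod.mk.eta (p := θ x), flip_inl_of_mem hx, ← hι, happ]
      rfl
    · rintro (⟨e, s⟩ | x) hd
      · have he : e ∉ S := by
          intro he
          obtain ⟨x, hx⟩ := (hrange (e, s)).2 he
          exact hd ⟨x, congrArg Sum.inl hx⟩
        rw [facePerm, mul_apply, flip_inl_of_notMem he]
        exact hσ₀.apply_eq _ he
      · rw [facePerm, mul_apply, flip_inr]
        exact hσ₀.apply_eq _ (Set.notMem_empty x)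
  have key : ∀ H : Finset V, ∃ σ : Perm (Dart E V), IsRotation (vert en) (darts S (H : Set V)) σ ∧
      (facePerm σ S).orbitCount + (H.filter fun x => ∃ q : E × Bool, q.1 ∈ S ∧ en q = x).card =
        (facePerm σ₀ S).orbitCount := by
    intro H
    induction H using Finset.induction_on with
    | empty => exact ⟨σ₀, by simpa using hσ₀, by simp⟩
    | insert x H hx ih =>
      obtain ⟨σ, hσ, hcount⟩ := ih
      obtain ⟨σ', hσ', h1, h2⟩ := hσ.exists_insert_inr (x := x) (by simpa using hx)
      refine ⟨σ', by simpa using hσ', ?_⟩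
      rw [Finset.filter_insert]
      split_ifs with hq
      · rw [Finset.card_insert_of_notMem (by simp [hx]), ← hcount, ← h1 hq]
        ring
      · rw [h2 hq, hcount]
  have := Fintype.ofFinite V
  obtain ⟨σ, hσ, hcount⟩ := key Finset.univ
  refine ⟨σ, by simpa using hσ, ?_⟩
  have : {x | ∃ q : E × Bool, q.1 ∈ S ∧ en q = x}.ncard =
      (Finset.univ.filter fun x => ∃ q : E × Bool, q.1 ∈ S ∧ en q = x).card := by
    rw [← Set.ncard_coe_finset]
    congr 1
    ext x
    simp
  omega

theorem IsRotation.exists_delete_inr {H : Set V} (h : IsRotation (vert en) (darts S H) σ) {x : V}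
    (hx : x ∈ H) {q : E × Bool} (hq : q.1 ∈ S) (hqx : en q = x) :
    ∃ σ' : Perm (Dart E V), IsRotation (vert en) (darts S (H \ {x})) σ' ∧
        (facePerm σ' S).orbitCount = (facePerm σ S).orbitCount + 1 := by
  have hd : (darts S (H \ {x}) : Set (Dart E V)) = darts S H \ {Sum.inr x} := by
    ext d
    rcases d with q | y <;> simp
  have hne : σ (Sum.inr x) ≠ Sum.inr x := by
    intro hfix
    exact not_sameCycle_of_apply_eq (y := Sum.inl q) hfix (by simp)
      ((h.sameCycle_iff (Sum.inr x) hx (Sum.inl q) hq).2 hqx.symm)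
  refine ⟨_, by rw [hd]; exact h.delete_dart hne, ?_⟩
  rw [facePerm, mul_assoc]
  refine orbitCount_swap_mul_of_sameCycle hne.symm ?_
  have : σ (Sum.inr x) = (σ * flip S : Perm (Dart E V)) (Sum.inr x) := by rw [mul_apply, flip_inr]
  rw [this]
  exact sameCycle_apply_right.2 (SameCycle.refl _ _)

/-- The half-edges of a rotation system can be removed if each vertex has an edge. -/
theorem IsRotation.exists_perm (hS : ∀ e, e ∈ S)
    (h : IsRotation (vert en) (darts S Set.univ) σ) (hen : Function.Surjective en) :
    ∃ ρ ι : Perm (E × Bool), (∀ q q', SameCycle ρ q q' ↔ en q = en q') ∧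
      (∀ q, ι q = (q.1, !q.2)) ∧ (ρ * ι).orbitCount = (facePerm σ S).orbitCount := by
  classical
  -- Each half-edge removed becomes a fixed point, hence one more orbit; these |V| orbits disappear
  -- on restriction to the darts of edges.
  have key : ∀ H : Finset V, ∃ σ' : Perm (Dart E V),
      IsRotation (vert en) (darts S (H : Set V)ᶜ) σ' ∧
      (facePerm σ' S).orbitCount = (facePerm σ S).orbitCount + H.card := by
    intro H
    induction H using Finset.induction_on with
    | empty => exact ⟨σ, by simpa using h, by simp⟩
    | insert x H hx ih =>
      obtain ⟨σ₁, hσ₁, hcount⟩ := ih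
      obtain ⟨q, hq⟩ := hen x
      obtain ⟨σ', hσ', h1⟩ := hσ₁.exists_delete_inr (x := x) (by simpa using hx) (hS q.1) hq
      refine ⟨σ', ?_, ?_⟩
      · convert hσ' using 2
        ext y
        simp [and_comm]
      · rw [h1, hcount, Finset.card_insert_of_notMem hx]
        ring
  have := Fintype.ofFinite V
  obtain ⟨σ', hσ', hcount⟩ := key Finset.univ
  rw [Finset.coe_univ, Set.compl_univ] at hσ'
  have hmem : ∀ q : E × Bool, (Sum.inl q : Dart E V) ∈ darts S ∅ := fun q => hS q.1
  have hex : ∀ q, ∃ q', σ' (Sum.inl q) = Sum.inl q' := by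
    intro q
    have := hσ'.apply_mem (hmem q)
    rcases hd : σ' (Sum.inl q) with q' | x
    · exact ⟨q', rfl⟩
    · rw [hd] at this
      exact absurd this (Set.notMem_empty x)
  choose g hg using hex
  have hgb : Function.Bijective g := by
    refine Finite.injective_iff_bijective.1 fun q q' hqq => ?_
    exact Sum.inl_injective (σ'.injective (by rw [hg, hg, hqq]))
  have hinv : Function.Involutive (fun q : E × Bool => (q.1, !q.2)) := fun q => by simp
  refine ⟨Equiv.ofBijective g hgb, hinv.toPerm, fun q q' => ?_, fun _ => rfl, ?_⟩
  · rw [← sameCycle_iff_of_semiconj (ρ := σ') Sum.inl_injective (fun q => hg q),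
      hσ'.sameCycle_iff _ (hmem q) _ (hmem q')]
    rfl
  · have h1 := orbitCount_eq_add_of_semiconj (π := Equiv.ofBijective g hgb * hinv.toPerm)
      (ρ := facePerm σ' S) (f := Sum.inl) Sum.inl_injective ?_ ?_
    · have h2 : (Set.range (Sum.inl : E × Bool → Dart E V))ᶜ.ncard = Nat.card V := by
        rw [Set.compl_range_inl, ← Nat.card_coe_set_eq, Nat.card_range_of_injective
          Sum.inr_injective]
      rw [h2, hcount, Finset.card_univ, Nat.card_eq_fintype_card] at h1
      omega
    · rintro ⟨e, s⟩
      rw [facePerm, mul_apply, flip_inl_of_mem (hS e), hg]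
      rfl
    · rintro (q | x) hd
      · exact absurd ⟨q, rfl⟩ hd
      · rw [facePerm, mul_apply, flip_inr]
        exact hσ'.apply_eq _ (Set.notMem_empty x)

end RotationSystem

/-! ### Oriented embeddings from permutations of darts -/

namespace Graph

open Equiv Equiv.Perm

variable {α : Type u} {β : Type v} {G : Graph α β}

/-- The flags are the darts with a sign. -/
def embeddingOfPerm {X : Type} [Finite X] {en : X → α} {ed : X → β} {ρ ι : Perm X}
    (hι : ∀ x, ι (ι x) = x) (hι_ne : ∀ x, ι x ≠ x)
    (hlink : ∀ x, G.IsLink (ed x) (en x) (en (ι x)))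
    (hex : ∀ e ∈ G.edgeSet, ∃ x, ed x = e)
    (hed : ∀ x y, ed x = ed y ↔ y = x ∨ y = ι x)
    (hρ : ∀ x y, SameCycle ρ x y ↔ en x = en y) : G.CellularEmbedding (X × Bool) where
  τ₀ x := (ι x.1, !x.2)
  -- The negative flag of a dart goes to the positive flag of the next dart, so that `τ₁ ∘ τ₂` is
  -- `ρ` on positive flags.
  τ₁ x := (if x.2 then ρ⁻¹ x.1 else ρ x.1, !x.2)
  τ₂ x := (x.1, !x.2)
  vert x := en x.1
  edge x := ed x.1
  τ₀_τ₀ x := by simp [hι]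
  τ₁_τ₁ x := by
    rcases x with ⟨x, _ | _⟩ <;> simp
  τ₂_τ₂ x := by simp
  τ₀_ne x h := by simpa using congrArg Prod.snd h
  τ₁_ne x h := by simpa using congrArg Prod.snd h
  τ₂_ne x h := by simpa using congrArg Prod.snd h
  τ₀_τ₂ x := rfl
  τ₀_τ₂_ne x h := hι_ne x.1 (congrArg Prod.fst h)
  isLink x := hlink x.1
  exists_edge_eq e he := by
    obtain ⟨x, hx⟩ := hex e he
    exact ⟨(x, true), hx⟩
  edge_eq_iff x y := by
    rw [hed]
    rcases x with ⟨x, _ | _⟩ <;> rcases y with ⟨y, _ | _⟩ <;> simp [or_comm]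
  vert_eq_iff x y := by
    rw [← hρ]
    set r : X × Bool → X × Bool → Prop := fun a b =>
      b = (if a.2 then ρ⁻¹ a.1 else ρ a.1, !a.2) ∨ b = (a.1, !a.2)
    have hsign : ∀ a : X, ∀ s t, Relation.EqvGen r (a, s) (a, t) := by
      intro a s t
      rcases Bool.eq_or_eq_not t s with rfl | rfl
      · exact .refl _
      · exact .rel _ _ (Or.inr rfl)
    constructor
    · intro h
      have := h.mem_of_forall_mem (P := {z | Relation.EqvGen r (x.1, false) (z, false)})
        (fun z hz => ?_) (.refl _)
      · exact ((hsign x.1 x.2 false).trans _ _ _ this).trans _ _ _ (hsign y.1 false y.2)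
      · exact (Relation.EqvGen.trans _ _ _ hz (.rel _ (ρ z, true) (Or.inl rfl))).trans _ _ _
          (hsign _ _ _)
    · intro h
      induction h with
      | rel a b hab =>
        rcases hab with rfl | rfl
        · rcases a with ⟨a, _ | _⟩
          · exact sameCycle_apply_right.2 (SameCycle.refl _ _)
          · exact ⟨-1, by simp⟩
        · exact SameCycle.refl _ _
      | refl a => exact SameCycle.refl _ _
      | symm a b _ ih => exact ih.symm
      | trans a b c _ _ ih1 ih2 => exact ih1.trans ih2

theorem exists_embedding_of_perm {X : Type} [Finite X] {en : X → α} {ed : X → β} {ρ ι : Perm X}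
    (hι : ∀ x, ι (ι x) = x) (hι_ne : ∀ x, ι x ≠ x)
    (hlink : ∀ x, G.IsLink (ed x) (en x) (en (ι x)))
    (hex : ∀ e ∈ G.edgeSet, ∃ x, ed x = e)
    (hed : ∀ x y, ed x = ed y ↔ y = x ∨ y = ι x)
    (hρ : ∀ x y, SameCycle ρ x y ↔ en x = en y) (hiso : ∀ a ∈ G.vertexSet, ∃ e, G.Inc e a) :
    ∃ M : G.CellularEmbedding (X × Bool), M.IsOrientable ∧
      Nat.card M.Face = (ρ * ι).orbitCount := by
  let M := embeddingOfPerm hι hι_ne hlink hex hed hρ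
  have hc : ∀ x : X × Bool, (M.τ₀ x).2 ≠ x.2 ∧ (M.τ₁ x).2 ≠ x.2 ∧ (M.τ₂ x).2 ≠ x.2 :=
    fun x => ⟨Bool.not_ne_self _, Bool.not_ne_self _, Bool.not_ne_self _⟩
  refine ⟨M, ⟨_, hc⟩, ?_⟩
  rw [M.card_face (c := fun x => x.2) hc hiso]
  let f : X → {x : X × Bool // x.2 = true} := fun x => ⟨(x, true), rfl⟩
  have hsurj : Function.Surjective f := by
    rintro ⟨⟨x, s⟩, hs⟩
    obtain rfl : s = true := hs
    exact ⟨x, rfl⟩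
  have h := orbitCount_eq_add_of_semiconj (π := ρ * ι) (ρ := M.rotation hc * M.reversal hc)
    (f := f) (fun x y hxy => congrArg (fun z => z.1.1) hxy) ?_ ?_
  · rw [h, hsurj.range_eq]
    simp
  · intro x
    rfl
  · intro y hy
    exact absurd (hsurj y) hy

end Graph

/-! ### The two sides of a separating dual cycle -/

namespace Graph.CellularEmbedding

variable {α : Type u} {β : Type v} {G : Graph α β} {Φ : Type w} (M : G.CellularEmbedding Φ)

theorem exists_vert_eq {e : β} {a b : α} (h : G.IsLink e a b) :
    ∃ x, M.edge x = e ∧ M.vert x = a ∧ M.vert (M.τ₀ x) = b := by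
  obtain ⟨x, rfl⟩ := M.exists_edge_eq e h.edge_mem
  rcases G.eq_or_eq_of_isLink_of_isLink h (M.isLink x) with h1 | h1
  · exact ⟨x, rfl, h1.symm, h.right_unique (h1 ▸ M.isLink x) |>.symm⟩
  · refine ⟨M.τ₀ x, M.edge_τ₀ x, h1.symm, ?_⟩
    rw [M.τ₀_τ₀]
    exact (h.right_unique (h1 ▸ (M.isLink x).symm)).symm

theorem exists_flag_of_isConnected (hG : G.IsConnected) [hΦ : Nonempty Φ] {a : α}
    (ha : a ∈ G.vertexSet) : ∃ x, M.vert x = a := by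
  obtain ⟨y⟩ := hΦ
  rcases Relation.ReflTransGen.cases_head (hG.2 a ha _ (M.isLink y).left_mem) with h | ⟨b, ⟨e, h⟩, -⟩
  · exact ⟨y, h.symm⟩
  · obtain ⟨x, -, hx, -⟩ := M.exists_vert_eq h
    exact ⟨x, hx⟩

theorem iff_of_vert_eq {h : Φ → Prop} (h₁ : ∀ x, h (M.τ₁ x) ↔ h x) (h₂ : ∀ x, h (M.τ₂ x) ↔ h x)
    {x y : Φ} (hxy : M.vert x = M.vert y) : h x ↔ h y := by
  have := (M.vert_eq_iff x y).1 hxy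
  induction this with
  | rel a b hab =>
    rcases hab with rfl | rfl
    · exact (h₁ _).symm
    · exact (h₂ _).symm
  | refl => exact Iff.rfl
  | symm a b _ ih => exact (ih (by rw [M.vert_eq_iff]; assumption)).symm
  | trans a b c h1 h2 ih1 ih2 =>
    exact (ih1 ((M.vert_eq_iff _ _).2 h1)).trans (ih2 ((M.vert_eq_iff _ _).2 h2))

theorem iff_of_isConnected (hG : G.IsConnected) {h : Φ → Prop} (h₀ : ∀ x, h (M.τ₀ x) ↔ h x)
    (h₁ : ∀ x, h (M.τ₁ x) ↔ h x) (h₂ : ∀ x, h (M.τ₂ x) ↔ h x) (x y : Φ) : h x ↔ h y := by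
  have key : ∀ b, Relation.ReflTransGen G.Adj (M.vert x) b → ∀ y, M.vert y = b → (h x ↔ h y) := by
    intro b hb
    induction hb with
    | refl => exact fun y hy => M.iff_of_vert_eq h₁ h₂ hy.symm
    | @tail b c _ hbc ih =>
      intro y hy
      obtain ⟨e, he⟩ := hbc
      obtain ⟨z, -, hz, hz'⟩ := M.exists_vert_eq he
      exact (ih z hz).trans ((h₀ z).symm.trans (M.iff_of_vert_eq h₁ h₂ (hz'.trans hy.symm)))
  exact key _ (hG.2 _ (M.isLink x).left_mem _ (M.isLink y).left_mem) y rfl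

theorem face_τ₁ (x : Φ) : M.face (M.τ₁ x) = M.face x :=
  congrArg Sum.inl (Quot.sound (Or.inr (M.τ₁_τ₁ x).symm))

theorem even_card_of_involution {X : Type*} {s : Finset X} {τ : X → X} (hτ : ∀ x, τ (τ x) = x)
    (hne : ∀ x, τ x ≠ x) (hs : ∀ x ∈ s, τ x ∈ s) : Even s.card := by
  have h : ∑ _x ∈ s, (1 : ZMod 2) = 0 :=
    Finset.sum_involution (fun x _ => τ x) (fun _ _ => by decide) (fun x _ _ => hne x)
      (fun x hx => hs x hx) (fun x _ => hτ x)
  rw [Finset.sum_const, nsmul_eq_mul, mul_one] at h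
  exact (ZMod.natCast_eq_zero_iff_even).1 h

variable {C : M.dual.Cycle}

/-- Neighbouring flags that are connected in the complement of `C`. -/
def Step (C : M.dual.Cycle) (x y : Φ) : Prop :=
  y = M.τ₁ x ∨ y = M.τ₂ x ∨ (M.edge x ∉ C.edges ∧ y = M.τ₀ x)

/-- The component of a flag in the complement of a cycle of the dual graph. -/
def region (C : M.dual.Cycle) (x : Φ) : M.Region C := Quot.mk _ x

theorem region_τ₁ (x : Φ) : M.region C (M.τ₁ x) = M.region C x :=
  (Quot.sound (r := M.Step C) (Or.inl rfl)).symm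

theorem region_τ₂ (x : Φ) : M.region C (M.τ₂ x) = M.region C x :=
  (Quot.sound (r := M.Step C) (Or.inr (Or.inl rfl))).symm

theorem region_τ₀ {x : Φ} (hx : M.edge x ∉ C.edges) : M.region C (M.τ₀ x) = M.region C x :=
  (Quot.sound (r := M.Step C) (Or.inr (Or.inr ⟨hx, rfl⟩))).symm

theorem region_eq_of_vert_eq {x y : Φ} (h : M.vert x = M.vert y) :
    M.region C x = M.region C y :=
  (M.iff_of_vert_eq (h := fun z => M.region C x = M.region C z)
    (fun z => by rw [M.region_τ₁]) (fun z => by rw [M.region_τ₂]) h).1 rfl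

/-- Exactly one of the two ends of the edge of `x` lies in the region `R`. -/
def Separates (R : M.Region C) (x : Φ) : Prop :=
  ¬ (M.region C x = R ↔ M.region C (M.τ₀ x) = R)

theorem separates_τ₀ (R : M.Region C) (x : Φ) : M.Separates R (M.τ₀ x) ↔ M.Separates R x := by
  rw [Separates, Separates, M.τ₀_τ₀, iff_comm (b := M.region C x = R)]

theorem separates_τ₂ (R : M.Region C) (x : Φ) : M.Separates R (M.τ₂ x) ↔ M.Separates R x := by
  rw [Separates, Separates, M.τ₀_τ₂, M.region_τ₂, M.region_τ₂]

theorem separates_iff_of_edge_eq (R : M.Region C) {x y : Φ} (h : M.edge x = M.edge y) :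
    M.Separates R x ↔ M.Separates R y := by
  rcases (M.edge_eq_iff x y).1 h with rfl | rfl | rfl | rfl
  · exact Iff.rfl
  · exact (M.separates_τ₀ R x).symm
  · exact (M.separates_τ₂ R x).symm
  · exact ((M.separates_τ₀ R _).trans (M.separates_τ₂ R x)).symm

theorem edge_mem_of_separates {R : M.Region C} {x : Φ} (h : M.Separates R x) :
    M.edge x ∈ C.edges := by
  by_contra hx
  exact h (by rw [M.region_τ₀ hx])

/-- The boundary of a face enters and leaves a region equally often. -/
theorem exists_separates_ne [Finite Φ] {R : M.Region C} {x : Φ} (hx : M.Separates R x) :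
    ∃ y, M.face y = M.face x ∧ M.Separates R y ∧ y ≠ x ∧ y ≠ M.τ₀ x := by
  classical
  have := Fintype.ofFinite Φ
  by_contra hcon
  push Not at hcon
  wlog hR : M.region C x = R generalizing x
  · have hR' : M.region C (M.τ₀ x) = R := by
      unfold Separates at hx
      tauto
    refine this ((M.separates_τ₀ R x).2 hx) (fun y hy hys hne => ?_) hR'
    rw [M.face_τ₀] at hy
    rw [M.τ₀_τ₀]
    by_contra hne'
    exact hne (hcon y hy hys hne')
  have hR' : M.region C (M.τ₀ x) ≠ R := fun h => hx (by simp [hR, h])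
  -- The flags of the face in `R` are paired by `τ₁`, and those whose `τ₀`-neighbour is also in `R`
  -- are paired by `τ₀`. Both numbers are even, so `x` cannot be the only flag in the difference.
  let s := Finset.univ.filter fun y => M.face y = M.face x ∧ M.region C y = R
  have h1 : Even s.card := even_card_of_involution M.τ₁_τ₁ M.τ₁_ne fun y hy => by
    simpa [s, M.face_τ₁, M.region_τ₁] using hy
  let t := s.filter fun y => M.region C (M.τ₀ y) = R
  have h2 : Even t.card := even_card_of_involution M.τ₀_τ₀ M.τ₀_ne fun y hy => by
    simp only [s, t, Finset.mem_filter, Finset.mem_univ, true_and, M.face_τ₀, M.τ₀_τ₀] at hy ⊢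
    tauto
  have hs : s = insert x t := by
    ext y
    simp only [s, t, Finset.mem_insert, Finset.mem_filter, Finset.mem_univ, true_and]
    constructor
    · rintro ⟨hy, hyR⟩
      by_cases hyx : y = x
      · exact Or.inl hyx
      · refine Or.inr ⟨⟨hy, hyR⟩, ?_⟩
        by_contra hn
        have := hcon y hy (fun h => hn (h.1 hyR)) hyx
        rw [this] at hyR
        exact hR' hyR
    · rintro (rfl | hy)
      · exact ⟨rfl, hR⟩
      · exact hy.1
  rw [hs, Finset.card_insert_of_notMem (by simp [t, hR'])] at h1
  exact (Nat.even_add_one.1 h1) h2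

/-- Since `C` passes a face only once, the face between two consecutive edges of `C` meets no other
edge of `C`; by parity one of the two separates `R` if and only if the other does. So all edges of
`C` separate `R` or none does. In the latter case `R` is closed under all three flag maps and, `G`
being connected, is the only region. -/
theorem separates_of_edge_mem [Finite Φ] (hG : G.IsConnected) {R S : M.Region C} (hRS : R ≠ S)
    {x : Φ} (hx : M.edge x ∈ C.edges) : M.Separates R x := by
  choose z hze hz hz' using C.isLink
  have hstep : ∀ i, M.Separates R (z i) ↔ M.Separates R (z (i + 1)) := by
    intro i
    have hfind : ∀ y, M.face y = C.vtx (i + 1) → M.Separates R y →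
        (y = z (i + 1) ∨ y = M.τ₀ (z (i + 1))) ∨ (y = M.τ₂ (z i) ∨ y = M.τ₀ (M.τ₂ (z i))) := by
      intro y hy hys
      obtain ⟨j, hj⟩ := M.edge_mem_of_separates hys
      have hyj := (M.edge_eq_iff (z j) y).1 ((hze j).trans hj)
      have h1 : M.face y = C.vtx j → j = i + 1 := fun h =>
        C.vtx_injective (h.symm.trans hy)
      have h2 : M.face y = C.vtx (j + 1) → j = i := fun h =>
        add_right_cancel (C.vtx_injective (h.symm.trans hy))
      rcases hyj with rfl | rfl | rfl | rfl
      · rw [h1 (hz j)]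
        exact Or.inl (Or.inl rfl)
      · rw [h1 ((M.face_τ₀ _).trans (hz j))]
        exact Or.inl (Or.inr rfl)
      · rw [h2 (hz' j)]
        exact Or.inr (Or.inl rfl)
      · rw [h2 ((M.face_τ₀ _).trans (hz' j))]
        exact Or.inr (Or.inr rfl)
    constructor
    · intro h
      have h' := (M.separates_τ₂ R _).2 h
      obtain ⟨y, hy, hys, hne, hne'⟩ := M.exists_separates_ne h'
      rcases hfind y (hy.trans (hz' i)) hys with (rfl | rfl) | (rfl | rfl)
      · exact hys
      · exact (M.separates_τ₀ R _).1 hys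
      · exact absurd rfl hne
      · exact absurd rfl hne'
    · intro h
      obtain ⟨y, hy, hys, hne, hne'⟩ := M.exists_separates_ne h
      rcases hfind y (hy.trans (hz (i + 1))) hys with (rfl | rfl) | (rfl | rfl)
      · exact absurd rfl hne
      · exact absurd rfl hne'
      · exact (M.separates_τ₂ R _).1 hys
      · exact (M.separates_τ₂ R _).1 ((M.separates_τ₀ R _).1 hys)
  have hall : ∀ i, M.Separates R (z i) ↔ M.Separates R (z 0) := by
    intro i
    induction i using Fin.induction with
    | zero => exact Iff.rfl
    | succ i ih => rw [← Fin.coeSucc_eq_succ, ← hstep, ih]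
  have hedge : ∀ x, M.edge x ∈ C.edges → (M.Separates R x ↔ M.Separates R (z 0)) := by
    rintro x ⟨i, hi⟩
    rw [← hall i]
    exact M.separates_iff_of_edge_eq R (hi.symm.trans (hze i).symm)
  rw [hedge x hx]
  by_contra h0
  obtain ⟨p, rfl⟩ := Quot.exists_rep R
  obtain ⟨q, rfl⟩ := Quot.exists_rep S
  refine hRS ((M.iff_of_isConnected hG
    (h := fun y => M.region C p = M.region C y) (fun y => ?_) (fun y => ?_) (fun y => ?_) p q).1 rfl)
  · by_cases hy : M.edge y ∈ C.edges
    · have : ¬ M.Separates (M.region C p) y := fun h => h0 ((hedge y hy).1 h)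
      rw [Separates, not_not] at this
      rw [eq_comm, ← this, eq_comm]
    · rw [M.region_τ₀ hy]
  · rw [M.region_τ₁]
  · rw [M.region_τ₂]

theorem region_τ₀_eq [Finite Φ] (hG : G.IsConnected) {R S : M.Region C} (hRS : R ≠ S)
    {x : Φ} (hx : M.edge x ∈ C.edges) (hxR : M.region C x = R) : M.region C (M.τ₀ x) = S := by
  have h := M.separates_of_edge_mem hG hRS.symm hx
  have : M.region C x ≠ S := hxR.trans_ne hRS
  unfold Separates at h
  tauto

/-- The complement of a separating cycle has exactly two components. -/
theorem region_eq_or_eq [Finite Φ] (hG : G.IsConnected) {R S : M.Region C} (hRS : R ≠ S) (x : Φ) :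
    M.region C x = R ∨ M.region C x = S := by
  obtain ⟨p, hp⟩ := Quot.exists_rep R
  have key : ∀ y, (M.region C y = R ∨ M.region C y = S) →
      (M.region C (M.τ₀ y) = R ∨ M.region C (M.τ₀ y) = S) := by
    intro y hy
    by_cases hyC : M.edge y ∈ C.edges
    · rcases hy with hy | hy
      · exact Or.inr (M.region_τ₀_eq hG hRS hyC hy)
      · exact Or.inl (M.region_τ₀_eq hG hRS.symm hyC hy)
    · rwa [M.region_τ₀ hyC]
  refine (M.iff_of_isConnected hG (h := fun y => M.region C y = R ∨ M.region C y = S)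
    (fun y => ⟨fun h => ?_, key y⟩) (fun y => ?_) (fun y => ?_) p x).1 (Or.inl hp)
  · have := key _ h
    rwa [M.τ₀_τ₀] at this
  · rw [M.region_τ₁]
  · rw [M.region_τ₂]

theorem mem_vertexSet_sideGraph {R : M.Region C} {a : α} :
    a ∈ (M.sideGraph C R).vertexSet ↔ ∃ x, M.vert x = a ∧ M.region C x = R := Iff.rfl

theorem vert_mem_sideGraph_iff {R : M.Region C} {x : Φ} :
    M.vert x ∈ (M.sideGraph C R).vertexSet ↔ M.region C x = R := by
  rw [M.mem_vertexSet_sideGraph]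
  constructor
  · rintro ⟨y, hy, rfl⟩
    exact M.region_eq_of_vert_eq hy.symm
  · exact fun h => ⟨x, rfl, h⟩

theorem sideGraph_le (R : M.Region C) : M.sideGraph C R ≤ G := by
  refine le_trans (Graph.induce_le ?_) Graph.deleteEdges_le
  rintro a ⟨x, rfl, -⟩
  exact (M.isLink x).left_mem

theorem edge_mem_sideGraph_iff {R : M.Region C} {x : Φ} :
    M.edge x ∈ (M.sideGraph C R).edgeSet ↔ M.edge x ∉ C.edges ∧ M.region C x = R := by
  constructor
  · intro h
    obtain ⟨a, b, h⟩ := Graph.exists_isLink_of_mem_edgeSet h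
    have h' : (G.IsLink (M.edge x) a b ∧ M.edge x ∉ C.edges) ∧
        a ∈ (M.sideGraph C R).vertexSet ∧ b ∈ (M.sideGraph C R).vertexSet := by
      refine ⟨?_, h.left_mem, h.right_mem⟩
      have := h.1
      rw [Graph.deleteEdges_isLink] at this
      exact this
    refine ⟨h'.1.2, ?_⟩
    rw [← M.vert_mem_sideGraph_iff]
    rcases G.eq_or_eq_of_isLink_of_isLink (M.isLink x) h'.1.1 with hx | hx
    · rw [hx]
      exact h'.2.1
    · rw [hx]
      exact h'.2.2
  · rintro ⟨hx, hR⟩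
    have hlink : (M.sideGraph C R).IsLink (M.edge x) (M.vert x) (M.vert (M.τ₀ x)) := by
      refine ⟨?_, ⟨x, rfl, hR⟩, ⟨M.τ₀ x, rfl, (M.region_τ₀ hx).trans hR⟩⟩
      rw [Graph.deleteEdges_isLink]
      exact ⟨M.isLink x, hx⟩
    exact hlink.edge_mem

/-- A side of a cycle of the dual graph is connected. -/
theorem exists_crossing_sideGraph {R : M.Region C} {X : Set α}
    (hX : ∃ a ∈ (M.sideGraph C R).vertexSet, a ∈ X)
    (hX' : ∃ a ∈ (M.sideGraph C R).vertexSet, a ∉ X) :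
    ∃ x, M.edge x ∈ (M.sideGraph C R).edgeSet ∧ M.vert x ∈ X ∧ M.vert (M.τ₀ x) ∉ X := by
  obtain ⟨_, ⟨p, rfl, hp⟩, hpX⟩ := hX
  obtain ⟨_, ⟨q, rfl, hq⟩, hqX⟩ := hX'
  by_contra hcon
  push Not at hcon
  -- If no edge of the side leaves `X`, then membership of the vertex in `X` is constant along steps
  -- inside `R`, so it descends to regions.
  let h : M.Region C → Prop := Quot.lift (fun x => M.region C x = R → M.vert x ∈ X) (by
    rintro x y (rfl | rfl | ⟨hx, rfl⟩)
    · rw [M.region_τ₁, M.vert_τ₁]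
    · rw [M.region_τ₂, M.vert_τ₂]
    · rw [M.region_τ₀ hx]
      refine propext (forall_congr' fun hR => ⟨fun hxX => ?_, fun hxX => ?_⟩)
      · exact hcon x (M.edge_mem_sideGraph_iff.2 ⟨hx, hR⟩) hxX
      · have := hcon (M.τ₀ x) (by
          rw [M.edge_τ₀]
          exact M.edge_mem_sideGraph_iff.2 ⟨hx, hR⟩) hxX
        rwa [M.τ₀_τ₀] at this)
  have h1 : h (M.region C p) := fun _ => hpX
  rw [show M.region C p = M.region C q from hp.trans hq.symm] at h1
  exact hqX (h1 hq)

end Graph.CellularEmbedding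

/-! ### Upper-embeddability in terms of rotation systems -/

namespace Graph

open Equiv Equiv.Perm RotationSystem

variable {α : Type u} {β : Type v} {G H : Graph α β}

theorem exists_ends (G : Graph α β) : ∃ en : G.edgeSet × Bool → G.vertexSet,
    ∀ e s, G.IsLink (e : G.edgeSet).1 (en (e, s)).1 (en (e, !s)).1 := by
  have h : ∀ e : G.edgeSet, ∃ x y : G.vertexSet, G.IsLink e.1 x.1 y.1 := by
    intro e
    obtain ⟨x, y, hxy⟩ := Graph.exists_isLink_of_mem_edgeSet e.2
    exact ⟨⟨x, hxy.left_mem⟩, ⟨y, hxy.right_mem⟩, hxy⟩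
  choose x y hxy using h
  refine ⟨fun q => if q.2 then y q.1 else x q.1, fun e s => ?_⟩
  cases s
  · exact hxy e
  · exact (hxy e).symm

namespace CellularEmbedding

variable {Φ : Type w} (M : H.CellularEmbedding Φ)

theorem eq_or_eq_reversal {c : Φ → Bool}
    (hc : ∀ x, c (M.τ₀ x) ≠ c x ∧ c (M.τ₁ x) ≠ c x ∧ c (M.τ₂ x) ≠ c x)
    {x y : {x // c x = true}} (h : M.edge x.1 = M.edge y.1) : y = x ∨ y = M.reversal hc x := by
  have hx := x.2
  have hy := y.2
  rcases (M.edge_eq_iff x.1 y.1).1 h with h | h | h | h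
  · exact Or.inl (Subtype.ext h)
  · rw [h, M.orient_τ₀ hc, hx] at hy
    simp at hy
  · rw [h, M.orient_τ₂ hc, hx] at hy
    simp at hy
  · exact Or.inr (Subtype.ext h)

/-- An oriented embedding of a subgraph gives a rotation system. -/
theorem exists_isRotation [Nonempty Φ] [Finite G.edgeSet] [Finite G.vertexSet]
    [DecidableEq G.edgeSet]
    [DecidableEq G.vertexSet] {en : G.edgeSet × Bool → G.vertexSet}
    (hen : ∀ e s, G.IsLink (e : G.edgeSet).1 (en (e, s)).1 (en (e, !s)).1) (hH : H ≤ G)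
    {S : Finset G.edgeSet} (hS : ∀ e, e ∈ S ↔ e.1 ∈ H.edgeSet) (hM : M.IsOrientable)
    (hiso : ∀ a ∈ H.vertexSet, ∃ e, H.Inc e a) :
    ∃ σ : Perm (Dart G.edgeSet G.vertexSet), IsRotation (RotationSystem.vert en) (darts S Set.univ) σ ∧
      (facePerm σ S).orbitCount + H.vertexSet.ncard + 2 * S.card =
        Nat.card M.Face + 2 * Nat.card G.edgeSet + Nat.card G.vertexSet := by
  classical
  obtain ⟨c, hc⟩ := hM
  have hEfin : H.edgeSet.Finite := (Set.toFinite G.edgeSet).subset hH.edgeSet_mono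
  have := M.finite_flags hEfin
  have hlink : ∀ e ∈ S, ∀ s, H.IsLink (e : G.edgeSet).1 (en (e, s)).1 (en (e, !s)).1 :=
    fun e he s => (hH.isLink_iff ((hS e).1 he)).2 (hen e s)
  have hbase : ∀ e : G.edgeSet, e ∈ S → ∃ x : {x // c x = true}, M.edge x.1 = e.1 ∧
      M.vert x.1 = (en (e, false)).1 ∧ M.vert (M.τ₀ x.1) = (en (e, true)).1 := by
    intro e he
    obtain ⟨x, hx, hx₁, hx₂⟩ := M.exists_vert_eq (hlink e he false)
    cases h : c x
    · refine ⟨⟨M.τ₂ x, by rw [M.orient_τ₂ hc, h]; rfl⟩, ?_, ?_, ?_⟩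
      · exact (M.edge_τ₂ x).trans hx
      · exact (M.vert_τ₂ x).trans hx₁
      · rw [M.τ₀_τ₂]
        exact (M.vert_τ₂ _).trans hx₂
    · exact ⟨⟨x, h⟩, hx, hx₁, hx₂⟩
  have hΦ : Nonempty {x // c x = true} := by
    obtain ⟨x⟩ := ‹Nonempty Φ›
    cases h : c x
    · exact ⟨M.τ₂ x, by rw [M.orient_τ₂ hc, h]; rfl⟩
    · exact ⟨x, h⟩
  choose! r hre hrv hrv' using hbase
  have hmem : ∀ x : Φ, ∃ e ∈ S, e.1 = M.edge x := fun x =>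
    ⟨⟨M.edge x, hH.edgeSet_mono (M.isLink x).edge_mem⟩, (hS _).2 (M.isLink x).edge_mem, rfl⟩
  choose E hES hE using hmem
  have hErev : ∀ x : {x // c x = true}, E (M.reversal hc x).1 = E x.1 := by
    intro x
    apply Subtype.ext
    rw [hE, hE]
    exact (M.edge_τ₀ _).trans (M.edge_τ₂ _)
  have hcases : ∀ x : {x // c x = true}, x = r (E x.1) ∨ x = M.reversal hc (r (E x.1)) :=
    fun x => M.eq_or_eq_reversal hc ((hre _ (hES _)).trans (hE _))
  have hrev : ∀ x : {x // c x = true}, M.reversal hc (M.reversal hc x) = x := by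
    intro x
    apply Subtype.ext
    change M.τ₀ (M.τ₂ (M.τ₀ (M.τ₂ x.1))) = x.1
    rw [M.τ₀_τ₂, M.τ₀_τ₀, M.τ₂_τ₂]
  have hrev_ne : ∀ x : {x // c x = true}, M.reversal hc x ≠ x := fun x h =>
    M.τ₀_τ₂_ne x.1 (congrArg Subtype.val h)
  have hEr : ∀ e ∈ S, E (r e).1 = e := fun e he =>
    Subtype.ext ((hE _).trans (hre e he))
  -- The sign records whether the flag is the chosen one at the `false` end of its edge or the
  -- reversal of that flag.
  let θ : {x // c x = true} → G.edgeSet × Bool := fun x => (E x.1, !decide (x = r (E x.1)))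
  have hθv : ∀ x, (en (θ x)).1 = M.vert x.1 := by
    intro x
    by_cases hx : x = r (E x.1)
    · have : θ x = (E x.1, false) := by simp [θ, ← hx]
      rw [this, ← hrv _ (hES _), ← hx]
    · have : θ x = (E x.1, true) := by simp [θ, hx]
      rw [this, ← hrv' _ (hES _)]
      conv_rhs => rw [(hcases x).resolve_left hx]
      change _ = M.vert (M.τ₀ (M.τ₂ _))
      rw [M.τ₀_τ₂, M.vert_τ₂]
  have hθ : Function.Injective θ := by
    intro x y hxy
    have h1 : E x.1 = E y.1 := congrArg Prod.fst hxy
    have h2 : (!decide (x = r (E x.1))) = !decide (y = r (E y.1)) := congrArg Prod.snd hxy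
    rw [Bool.not_inj_iff, decide_eq_decide, h1] at h2
    by_cases hy : y = r (E y.1)
    · exact (h2.2 hy).trans hy.symm
    · have hx := (hcases x).resolve_left (by rw [h1]; exact fun h => hy (h2.1 h))
      rw [hx, (hcases y).resolve_left hy, h1]
  have hrange : ∀ q, q ∈ Set.range θ ↔ q.1 ∈ S := by
    rintro ⟨e, s⟩
    constructor
    · rintro ⟨x, hx⟩
      have : E x.1 = e := congrArg Prod.fst hx
      rw [← this]
      exact hES _
    · intro he
      cases s
      · exact ⟨r e, by simp [θ, hEr e he]⟩
      · exact ⟨M.reversal hc (r e), by simp [θ, hErev, hEr e he, hrev_ne]⟩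
  have hρ : ∀ x y, SameCycle (M.rotation hc) x y ↔ en (θ x) = en (θ y) := by
    intro x y
    rw [M.sameCycle_rotation_iff hc, ← hθv, ← hθv, Subtype.ext_iff]
  have hι : ∀ x, θ (M.reversal hc x) = ((θ x).1, !(θ x).2) := by
    intro x
    refine Prod.ext (hErev x) ?_
    change (!decide (M.reversal hc x = r (E (M.reversal hc x).1))) = !!decide (x = r (E x.1))
    rw [hErev, Bool.not_inj_iff]
    rcases hcases x with hx | hx
    · rw [← hx]
      simp [hrev_ne]
    · have h1 : M.reversal hc x = r (E x.1) := by
        conv_lhs => rw [hx]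
        rw [hrev]
      rw [h1]
      have h2 : x ≠ r (E x.1) := fun h => hrev_ne x (h1.trans h.symm)
      simp [h2]
  obtain ⟨σ, hσ, hcount⟩ := exists_isRotation_of_perm hθ hrange hρ hι
  refine ⟨σ, hσ, ?_⟩
  have h1 : {x | ∃ q : G.edgeSet × Bool, q.1 ∈ S ∧ en q = x}.ncard = H.vertexSet.ncard := by
    rw [← Set.ncard_image_of_injective _ Subtype.val_injective]
    congr 1
    ext a
    constructor
    · rintro ⟨_, ⟨⟨e, s⟩, he, rfl⟩, rfl⟩
      exact (hlink e he s).left_mem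
    · intro ha
      obtain ⟨e, b, he⟩ := hiso a ha
      obtain ⟨x, -, hx, -⟩ := M.exists_vert_eq he
      cases h : c x
      · refine ⟨_, ⟨θ ⟨M.τ₂ x, by rw [M.orient_τ₂ hc, h]; rfl⟩, hES _, rfl⟩, ?_⟩
        rw [hθv, M.vert_τ₂, hx]
      · exact ⟨_, ⟨θ ⟨x, h⟩, hES _, rfl⟩, (hθv _).trans hx⟩
  rw [← h1, M.card_face hc hiso]
  exact hcount

end CellularEmbedding

theorem card_eq_ncard (hH : H ≤ G) {S : Finset G.edgeSet} (hS : ∀ e, e ∈ S ↔ e.1 ∈ H.edgeSet)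
    {A : Finset G.vertexSet} (hA : ∀ a, a ∈ A ↔ a.1 ∈ H.vertexSet) :
    H.edgeSet.ncard = S.card ∧ H.vertexSet.ncard = A.card := by
  constructor
  · rw [← Set.ncard_coe_finset, ← Set.ncard_image_of_injective _ Subtype.val_injective]
    congr 1
    ext e
    constructor
    · exact fun he => ⟨⟨e, hH.edgeSet_mono he⟩, (hS _).2 he, rfl⟩
    · rintro ⟨e, he, rfl⟩
      exact (hS e).1 he
  · rw [← Set.ncard_coe_finset, ← Set.ncard_image_of_injective _ Subtype.val_injective]
    congr 1
    ext a
    constructor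
    · exact fun ha => ⟨⟨a, hH.vertexSet_mono ha⟩, (hA _).2 ha, rfl⟩
    · rintro ⟨a, ha, rfl⟩
      exact (hA a).1 ha

/-- An embedding of genus ⌊β/2⌋ has 1 + β mod 2 faces, so by `IsRotation.exists_reduces` the cost
over a spanning tree is β mod 2. -/
theorem UpperEmbeddable.exists_tree [Finite G.edgeSet] [Finite G.vertexSet]
    [DecidableEq G.edgeSet] [DecidableEq G.vertexSet] {en : G.edgeSet × Bool → G.vertexSet}
    (hen : ∀ e s, G.IsLink (e : G.edgeSet).1 (en (e, s)).1 (en (e, !s)).1) (hH : H ≤ G)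
    {S : Finset G.edgeSet} (hS : ∀ e, e ∈ S ↔ e.1 ∈ H.edgeSet)
    {A : Finset G.vertexSet} (hA : ∀ a, a ∈ A ↔ a.1 ∈ H.vertexSet) (hne : A.Nonempty)
    (hconn : ∀ B ⊂ A, B.Nonempty → Crosses en S (B : Set G.vertexSet))
    (hup : H.UpperEmbeddable) :
    ∃ T, IsTree en A T ∧ Reduces en T S (H.betti % 2) := by
  obtain ⟨hcE, hcV⟩ := card_eq_ncard hH hS hA
  have hSA : ∀ e ∈ S, ∀ s, en (e, s) ∈ A := fun e he s =>
    (hA _).2 <| Graph.IsLink.left_mem <| ((hH.isLink_iff ((hS e).1 he)).2 (hen e s))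
  have hβ : H.betti = S.card - A.card + 1 := by rw [betti, hcE, hcV]
  rw [UpperEmbeddable] at hup
  -- The value 0 may be a default of `sSup`, in which case it provides no embedding. But it forces β
  -- to be 0 or 1, and then any spanning tree will do, with β single edges added. A positive value
  -- is attained.
  rcases Nat.eq_zero_or_pos H.maxGenus with h0 | hpos
  · obtain ⟨T, hTS, hT⟩ := IsTree.exists_of_crosses hne hSA hconn
    refine ⟨T, hT, ?_⟩
    have h1 : H.betti % 2 = ((S \ T).card : ℤ) := by
      have h2 := Finset.card_sdiff_add_card_eq_card hTS
      have h3 := hT.card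
      rw [h0] at hup
      push_cast at hup
      omega
    rw [h1]
    exact Reduces.of_subset hTS
  · have hmem : H.maxGenus ∈ {k : ℕ | H.EmbedsInOrientableGenus k} := by
      have hbdd : BddAbove {k : ℕ | H.EmbedsInOrientableGenus k} := by
        by_contra hb
        have : H.maxGenus = 0 := Nat.sSup_of_not_bddAbove hb
        omega
      have hnon : {k : ℕ | H.EmbedsInOrientableGenus k}.Nonempty := by
        by_contra hn
        rw [Set.not_nonempty_iff_eq_empty] at hn
        have : H.maxGenus = 0 := by rw [maxGenus, hn, csSup_empty]; rfl
        omega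
      exact Nat.sSup_mem hnon hbdd
    obtain ⟨Φ, M, hM, hχ⟩ := hmem
    rw [CellularEmbedding.eulerChar, hcE, hcV] at hχ
    have hiso : ∀ a ∈ H.vertexSet, ∃ e, H.Inc e a := by
      intro a ha
      have haA : (⟨a, hH.vertexSet_mono ha⟩ : G.vertexSet) ∈ A := (hA _).2 ha
      have hinc : ∀ e ∈ S, ∀ s, (en (e, s)).1 = a → ∃ e, H.Inc e a := by
        rintro e he s rfl
        exact ⟨e.1, _, (hH.isLink_iff ((hS e).1 he)).2 (hen e s)⟩
      by_cases hB : {⟨a, hH.vertexSet_mono ha⟩} = A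
      · have hS0 : S.Nonempty := by
          rw [← Finset.card_pos]
          have := hne.card_pos
          omega
        obtain ⟨e, he⟩ := hS0
        have h1 := hSA e he false
        rw [← hB, Finset.mem_singleton] at h1
        exact hinc e he false (congrArg Subtype.val h1)
      · obtain ⟨e, he, s, hs, -⟩ := hconn {⟨a, hH.vertexSet_mono ha⟩}
          ((Finset.singleton_subset_iff.2 haA).ssubset_of_ne hB) (Finset.singleton_nonempty _)
        rw [Finset.coe_singleton, Set.mem_singleton_iff] at hs
        exact hinc e he s (congrArg Subtype.val hs)
    have hΦ : Nonempty Φ := by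
      obtain ⟨a, ha⟩ := hne
      obtain ⟨e, b, he⟩ := hiso a.1 ((hA a).1 ha)
      obtain ⟨x, -⟩ := M.exists_vert_eq he
      exact ⟨x⟩
    obtain ⟨σ, hσ, hcount⟩ := M.exists_isRotation hen hH hS hM hiso
    obtain ⟨T, j, hT, hX, hsp, hj⟩ := hσ.exists_reduces
    have htree : IsTree en A T := IsTree.of_sparse hne (fun e he => hSA e (hT.subset he))
      (fun B hB hB' => hX _ (hconn B hB hB')) hsp
    refine ⟨T, htree, ?_⟩
    have hTc := htree.card
    have : H.betti % 2 = j := by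
      rw [hcV] at hcount
      omega
    rwa [this]

theorem EmbedsInOrientableGenus.two_mul_le {k : ℕ} (hV : G.vertexSet.Finite)
    (hE : G.edgeSet.Finite) (hne : G.vertexSet.Nonempty) (h : G.EmbedsInOrientableGenus k) :
    2 * (k : ℤ) ≤ G.betti := by
  obtain ⟨Φ, M, -, hχ⟩ := h
  have := M.finite_flags hE
  have := hV.to_subtype
  have : Finite {a : α // a ∈ G.vertexSet ∧ ∀ e, ¬ G.Inc e a} :=
    Finite.of_injective (fun a => (⟨a.1, a.2.1⟩ : G.vertexSet))
      fun a b hab => Subtype.ext (congrArg (fun z : G.vertexSet => z.1) hab)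
  have hfin : Finite M.Face :=
    inferInstanceAs (Finite (Quot _ ⊕ {a : α // a ∈ G.vertexSet ∧ ∀ e, ¬ G.Inc e a}))
  have hnon : Nonempty M.Face := by
    obtain ⟨a, ha⟩ := hne
    by_cases he : ∃ e, G.Inc e a
    · obtain ⟨e, b, he⟩ := he
      obtain ⟨x, -⟩ := M.exists_vert_eq he
      exact ⟨M.face x⟩
    · exact ⟨Sum.inr ⟨a, ha, not_exists.1 he⟩⟩
  have hpos : 0 < Nat.card M.Face := Nat.card_pos
  rw [CellularEmbedding.eulerChar] at hχ
  rw [betti]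
  omega

theorem bddAbove_genus (hV : G.vertexSet.Finite) (hE : G.edgeSet.Finite)
    (hne : G.vertexSet.Nonempty) : BddAbove {k : ℕ | G.EmbedsInOrientableGenus k} :=
  ⟨G.betti.toNat, fun k hk => by
    have := EmbedsInOrientableGenus.two_mul_le hV hE hne hk
    omega⟩

theorem maxGenus_le (hV : G.vertexSet.Finite) (hE : G.edgeSet.Finite)
    (hne : G.vertexSet.Nonempty) (hβ : 0 ≤ G.betti) : (G.maxGenus : ℤ) ≤ G.betti / 2 := by
  rcases {k : ℕ | G.EmbedsInOrientableGenus k}.eq_empty_or_nonempty with h | h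
  · rw [maxGenus, h, csSup_empty]
    -- Without any embedding the supremum is 0, which is why β must be known to be nonnegative.
    have : ((⊥ : ℕ) : ℤ) = 0 := rfl
    omega
  · have := EmbedsInOrientableGenus.two_mul_le hV hE hne
      (Nat.sSup_mem h (bddAbove_genus hV hE hne))
    change 2 * (G.maxGenus : ℤ) ≤ _ at this
    omega

/-- A rotation system of the whole graph gives an embedding in an orientable surface. -/
theorem exists_embedding_of_faceBound [Finite G.edgeSet] [Finite G.vertexSet]
    [DecidableEq G.edgeSet] [DecidableEq G.vertexSet] {en : G.edgeSet × Bool → G.vertexSet}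
    (hen : ∀ e s, G.IsLink (e : G.edgeSet).1 (en (e, s)).1 (en (e, !s)).1)
    (hsurj : Function.Surjective en) {S : Finset G.edgeSet} (hS : ∀ e, e ∈ S) {F : ℤ}
    (h : FaceBound en S F) :
    ∃ (Φ : Type) (M : G.CellularEmbedding Φ), M.IsOrientable ∧
      ∃ i : ℕ, (Nat.card M.Face : ℤ) + 2 * i = F := by
  obtain ⟨σ, hσ, i, hi⟩ := h
  obtain ⟨ρ, ι, hρ, hι, hcount⟩ := hσ.exists_perm hS hsurj
  -- The darts are relabelled by a finite type in the lowest universe, as `EmbedsInOrientableGenus`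
  -- requires.
  obtain ⟨κ⟩ : Nonempty (G.edgeSet × Bool ≃ Fin (Nat.card G.edgeSet) × Bool) :=
    ⟨(Finite.equivFin G.edgeSet).prodCongr (Equiv.refl _)⟩
  have hι2 : ∀ q, ι (ι q) = q := fun q => by rw [hι, hι]; simp
  have hιne : ∀ q, ι q ≠ q := fun q h => by
    rw [hι] at h
    simpa using congrArg Prod.snd h
  have hS' : S.card = Nat.card G.edgeSet := by
    have := Fintype.ofFinite G.edgeSet
    rw [Finset.eq_univ_iff_forall.2 hS, Finset.card_univ, Nat.card_eq_fintype_card]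
  have hρκ : ∀ q, κ.permCongr ρ (κ q) = κ (ρ q) := fun q => by
    rw [Equiv.permCongr_apply, Equiv.symm_apply_apply]
  obtain ⟨M, hM, hMF⟩ := exists_embedding_of_perm (G := G) (X := Fin (Nat.card G.edgeSet) × Bool)
    (en := fun x => (en (κ.symm x)).1) (ed := fun x => (κ.symm x).1.1)
    (ρ := κ.permCongr ρ) (ι := κ.permCongr ι) (fun x => by
      rw [Equiv.permCongr_apply, Equiv.permCongr_apply, Equiv.symm_apply_apply, hι2,
        Equiv.apply_symm_apply])
    (fun x h => hιne (κ.symm x) (κ.injective (by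
      rw [Equiv.permCongr_apply] at h
      rw [h, Equiv.apply_symm_apply])))
    (fun x => by
      rw [Equiv.permCongr_apply, Equiv.symm_apply_apply, hι]
      exact hen _ _)
    (fun e he => ⟨κ (⟨e, he⟩, true), by rw [Equiv.symm_apply_apply]⟩)
    (fun x y => by
      rw [Equiv.permCongr_apply, ← Equiv.symm_apply_eq, hι, Subtype.val_inj,
        ← κ.symm.apply_eq_iff_eq (x := y)]
      generalize κ.symm x = p
      generalize κ.symm y = q
      obtain ⟨e, s⟩ := p
      obtain ⟨f, t⟩ := q
      cases s <;> cases t <;> simp [eq_comm])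
    (fun x y => by
      rw [Subtype.val_inj, ← hρ, ← sameCycle_iff_of_semiconj κ.injective hρκ,
        Equiv.apply_symm_apply, Equiv.apply_symm_apply])
    (fun a ha => by
      obtain ⟨⟨e, s⟩, hq⟩ := hsurj ⟨a, ha⟩
      have := hen e s
      rw [hq] at this
      exact ⟨e.1, _, this⟩)
  refine ⟨_, M, hM, i, ?_⟩
  have h1 := orbitCount_eq_add_of_semiconj (π := ρ * ι) (ρ := κ.permCongr ρ * κ.permCongr ι)
    κ.injective (fun q => by
      rw [mul_apply, Equiv.permCongr_apply, Equiv.permCongr_apply, Equiv.symm_apply_apply,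
        Equiv.symm_apply_apply, mul_apply]) (fun y hy => absurd (κ.surjective y) hy)
  rw [κ.surjective.range_eq, Set.compl_univ, Set.ncard_empty, add_zero] at h1
  rw [hMF, h1, hcount]
  rw [hS'] at hi
  linarith

end Graph

/-! ### Spanning trees of the two sides -/

namespace Graph.CellularEmbedding

open Equiv Equiv.Perm RotationSystem

variable {α β Φ : Type*} {G : Graph α β} (M : G.CellularEmbedding Φ)

theorem exists_ends_eq {en : G.edgeSet × Bool → G.vertexSet}
    (hen : ∀ e s, G.IsLink (e : G.edgeSet).1 (en (e, s)).1 (en (e, !s)).1) {x : Φ}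
    {e : G.edgeSet} (he : M.edge x = e.1) :
    ∃ s, (en (e, s)).1 = M.vert x ∧ (en (e, !s)).1 = M.vert (M.τ₀ x) := by
  have h := M.isLink x
  rw [he] at h
  rcases G.eq_or_eq_of_isLink_of_isLink h (hen e false) with h1 | h1
  · refine ⟨false, h1.symm, ?_⟩
    rw [h1] at h
    exact (h.right_unique (hen e false)).symm
  · refine ⟨true, h1.symm, ?_⟩
    rw [h1] at h
    exact (h.right_unique (hen e true)).symm

theorem exists_tree_sideGraph [Finite G.edgeSet] [Finite G.vertexSet]
    [DecidableEq G.edgeSet] [DecidableEq G.vertexSet] {en : G.edgeSet × Bool → G.vertexSet}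
    (hen : ∀ e s, G.IsLink (e : G.edgeSet).1 (en (e, s)).1 (en (e, !s)).1) {C : M.dual.Cycle}
    {R : M.Region C} {S : Finset G.edgeSet} (hS : ∀ e, e ∈ S ↔ e.1 ∈ (M.sideGraph C R).edgeSet)
    {A : Finset G.vertexSet} (hA : ∀ a, a ∈ A ↔ a.1 ∈ (M.sideGraph C R).vertexSet)
    (hup : (M.sideGraph C R).UpperEmbeddable) :
    ∃ T, IsTree en A T ∧ Reduces en T S ((M.sideGraph C R).betti % 2) := by
  have hle := M.sideGraph_le R
  refine UpperEmbeddable.exists_tree hen hle hS hA ?_ (fun B hBA hB => ?_) hup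
  · obtain ⟨x, hx⟩ := Quot.exists_rep R
    exact ⟨⟨M.vert x, (M.isLink x).left_mem⟩, (hA _).2 (M.vert_mem_sideGraph_iff.2 hx)⟩
  · obtain ⟨b, hb⟩ := hB
    obtain ⟨a, haA, haB⟩ := Finset.exists_of_ssubset hBA
    have hval : ∀ v : G.vertexSet, v.1 ∈ Subtype.val '' (B : Set G.vertexSet) ↔ v ∈ B := by
      intro v
      rw [Subtype.val_injective.mem_set_image, Finset.mem_coe]
    obtain ⟨x, hx, hxB, hxB'⟩ := M.exists_crossing_sideGraph
      (X := Subtype.val '' (B : Set G.vertexSet))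
      ⟨b.1, (hA b).1 (hBA.1 hb), (hval b).2 hb⟩ ⟨a.1, (hA a).1 haA, fun h => haB ((hval a).1 h)⟩
    obtain ⟨s, hs, hs'⟩ := M.exists_ends_eq hen (x := x)
      (e := ⟨M.edge x, hle.edgeSet_mono hx⟩) rfl
    refine ⟨⟨M.edge x, hle.edgeSet_mono hx⟩, (hS _).2 hx, s, ?_, ?_⟩
    · rw [← hs, hval] at hxB
      exact hxB
    · rw [← hs', hval] at hxB'
      exact hxB'

end Graph.CellularEmbedding

/-! ### Assembling the embedding of the whole graph -/

namespace Graph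

open Equiv Equiv.Perm RotationSystem

theorem exists_genus_of_sideGraph_upperEmbeddable {α β Φ : Type*} {G : Graph α β}
    (hV : G.vertexSet.Finite) (hE : G.edgeSet.Finite) (hG : G.IsConnected)
    (M : G.CellularEmbedding Φ) (C : M.dual.Cycle) {L R : M.Region C} (hLR : L ≠ R)
    (hL : (M.sideGraph C L).UpperEmbeddable) (hR : (M.sideGraph C R).UpperEmbeddable) :
    ∃ (k c : ℕ), G.EmbedsInOrientableGenus k ∧
      G.betti = (M.sideGraph C L).betti + (M.sideGraph C R).betti + c ∧
      0 ≤ (M.sideGraph C L).betti ∧ 0 ≤ (M.sideGraph C R).betti ∧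
      (M.sideGraph C L).betti / 2 + (M.sideGraph C R).betti / 2 + c / 2 ≤ (k : ℤ) := by
  classical
  have := hE.to_subtype
  have := hV.to_subtype
  have := M.finite_flags hE
  have := Fintype.ofFinite G.edgeSet
  have := Fintype.ofFinite G.vertexSet
  obtain ⟨en, hen⟩ := exists_ends G
  let S : M.Region C → Finset G.edgeSet := fun R =>
    Finset.univ.filter fun e => e.1 ∈ (M.sideGraph C R).edgeSet
  let A : M.Region C → Finset G.vertexSet := fun R =>
    Finset.univ.filter fun a => a.1 ∈ (M.sideGraph C R).vertexSet
  let D : Finset G.edgeSet := Finset.univ.filter fun e => e.1 ∈ C.edges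
  have hS : ∀ R e, e ∈ S R ↔ e.1 ∈ (M.sideGraph C R).edgeSet := fun R e => by simp [S]
  have hA : ∀ R a, a ∈ A R ↔ a.1 ∈ (M.sideGraph C R).vertexSet := fun R e => by simp [A]
  have hD : ∀ e, e ∈ D ↔ e.1 ∈ C.edges := fun e => by simp [D]
  obtain ⟨TL, hTL, hredL⟩ := M.exists_tree_sideGraph hen (hS L) (hA L) hL
  obtain ⟨TR, hTR, hredR⟩ := M.exists_tree_sideGraph hen (hS R) (hA R) hR
  obtain ⟨z, hz, -, -⟩ := C.isLink 0
  have hΦ : Nonempty Φ := ⟨z⟩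
  have hDne : D.Nonempty :=
    ⟨⟨M.edge z, (M.isLink z).edge_mem⟩, (hD _).2 ⟨0, hz.symm⟩⟩
  have hSR : ∀ R (e : G.edgeSet) x, M.edge x = e.1 →
      (e ∈ S R ↔ e ∉ D ∧ M.region C x = R) := by
    intro R e x hx
    rw [hS, hD, ← hx, M.edge_mem_sideGraph_iff]
  have hcover : ∀ e, e ∈ S R ∪ (S L ∪ D) := by
    intro e
    obtain ⟨x, hx⟩ := M.exists_edge_eq e.1 e.2
    rw [Finset.mem_union, Finset.mem_union, hSR R e x hx, hSR L e x hx]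
    rcases M.region_eq_or_eq hG hLR x with h | h <;> tauto
  have hSD : ∀ R, Disjoint (S R) D := by
    intro R
    rw [Finset.disjoint_left]
    intro e he
    obtain ⟨x, hx⟩ := M.exists_edge_eq e.1 e.2
    exact ((hSR R e x hx).1 he).1
  have hSS : Disjoint (S L) (S R) := by
    rw [Finset.disjoint_left]
    intro e he he'
    obtain ⟨x, hx⟩ := M.exists_edge_eq e.1 e.2
    exact hLR (((hSR L e x hx).1 he).2.symm.trans ((hSR R e x hx).1 he').2)
  have hflag : ∀ a : G.vertexSet, ∃ x, M.vert x = a.1 := fun a =>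
    M.exists_flag_of_isConnected hG a.2
  have hAR : ∀ R (a : G.vertexSet) x, M.vert x = a.1 → (a ∈ A R ↔ M.region C x = R) := by
    intro R a x hx
    rw [hA, ← hx, M.vert_mem_sideGraph_iff]
  have hAA : Disjoint (A L) (A R) := by
    rw [Finset.disjoint_left]
    intro a ha ha'
    obtain ⟨x, hx⟩ := hflag a
    exact hLR (((hAR L a x hx).1 ha).symm.trans ((hAR R a x hx).1 ha'))
  have hAcover : ∀ a, a ∈ A L ∪ A R := by
    intro a
    obtain ⟨x, hx⟩ := hflag a
    rw [Finset.mem_union, hAR L a x hx, hAR R a x hx]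
    exact M.region_eq_or_eq hG hLR x
  have hDcut : ∀ e ∈ D, ∃ s, en (e, s) ∈ A L ∧ en (e, !s) ∈ A R := by
    intro e he
    obtain ⟨x, hx⟩ := M.exists_edge_eq e.1 e.2
    have hxC : M.edge x ∈ C.edges := by
      rw [hx]
      exact (hD e).1 he
    obtain ⟨s, hs, hs'⟩ := M.exists_ends_eq hen hx
    rcases M.region_eq_or_eq hG hLR x with h | h
    · exact ⟨s, (hAR L _ x hs.symm).2 h,
        (hAR R _ _ hs'.symm).2 (M.region_τ₀_eq hG hLR hxC h)⟩
    · exact ⟨!s, (hAR L _ _ hs'.symm).2 (M.region_τ₀_eq hG hLR.symm hxC h),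
        (hAR R _ x (by rw [Bool.not_not]; exact hs.symm)).2 h⟩
  have hVc : Nat.card G.vertexSet = (A L).card + (A R).card := by
    rw [← Finset.card_union_of_disjoint hAA, Finset.eq_univ_iff_forall.2 hAcover,
      Finset.card_univ, Nat.card_eq_fintype_card]
  have hEc : Nat.card G.edgeSet = (S L).card + (S R).card + D.card := by
    rw [Nat.card_eq_fintype_card, ← Finset.card_univ, ← Finset.eq_univ_iff_forall.2 hcover,
      Finset.card_union_of_disjoint
        (Finset.disjoint_union_right.2 ⟨hSS.symm, hSD R⟩),
      Finset.card_union_of_disjoint (hSD L)]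
    ring
  obtain ⟨hLE, hLV⟩ := card_eq_ncard (M.sideGraph_le L) (hS L) (hA L)
  obtain ⟨hRE, hRV⟩ := card_eq_ncard (M.sideGraph_le R) (hS R) (hA R)
  have hβL : (M.sideGraph C L).betti = (S L).card - (A L).card + 1 := by rw [betti, hLE, hLV]
  have hβR : (M.sideGraph C R).betti = (S R).card - (A R).card + 1 := by rw [betti, hRE, hRV]
  have hβ : G.betti = ((S L).card + (S R).card + D.card : ℤ) - ((A L).card + (A R).card) + 1 := by
    rw [betti, ← Nat.card_coe_set_eq, ← Nat.card_coe_set_eq, hVc, hEc]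
    push_cast
    ring
  have hcL := hTL.card
  have hcR := hTR.card
  have hDpos := hDne.card_pos
  have hTLS := Finset.card_le_card hredL.subset
  have hTRS := Finset.card_le_card hredR.subset
  have h0 : FaceBound en (TL ∪ TR ∪ D) (((D.card - 1) % 2 : ℕ) + 1) :=
    hTL.faceBound_union hTR hAA hDcut hDne (by
      rw [hVc, ← hcL, ← hcR]
      push_cast
      ring)
  -- The left tree is completed to the left side while the right tree and the cut are kept; then the
  -- right tree is completed. Each costs the parity of the Betti number of its side.
  have hTRL : Disjoint TR (S L) := hSS.symm.mono_left hredR.subset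
  have h1 := hredL.bound (TR ∪ D) (Finset.disjoint_union_left.2 ⟨hTRL, (hSD L).symm⟩) _
    (by rwa [← Finset.union_assoc])
  have h2 := hredR.bound (S L ∪ D) (Finset.disjoint_union_left.2 ⟨hSS, (hSD R).symm⟩) _
    (by rwa [Finset.union_left_comm])
  have hsurj : Function.Surjective en := by
    intro a
    obtain ⟨x, hx⟩ := hflag a
    obtain ⟨s, hs, -⟩ := M.exists_ends_eq hen (x := x) (e := ⟨M.edge x, (M.isLink x).edge_mem⟩) rfl
    exact ⟨_, Subtype.ext (hs.trans hx)⟩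
  obtain ⟨Ψ, N, hN, i, hi⟩ := exists_embedding_of_faceBound hen hsurj hcover h2
  -- The face bound and `G.betti + 1` have the same parity, and `FaceBound` preserves parity, so
  -- Euler's formula gives an integral genus.
  obtain ⟨k, hk⟩ : ∃ k : ℕ, 2 * (k : ℤ) = G.betti + 1 - Nat.card N.Face := by
    refine ⟨((G.betti + 1 - Nat.card N.Face) / 2).toNat, ?_⟩
    omega
  refine ⟨k, D.card - 1, ⟨Ψ, N, hN, ?_⟩, ?_, ?_, ?_, ?_⟩
  · rw [CellularEmbedding.eulerChar, hk, betti]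
    ring
  all_goals omega

end Graph

theorem theorem7 {α : Type*} {β : Type*} {Φ : Type*} (G : Graph α β)
    (hV : G.vertexSet.Finite) (hE : G.edgeSet.Finite) (hG : G.IsConnected)
    (M : G.CellularEmbedding Φ) (C : M.dual.Cycle) (hC : M.SurfaceSeparating C)
    (L R : M.Region C) (hLR : L ≠ R)
    (hL : (M.sideGraph C L).UpperEmbeddable) (hR : (M.sideGraph C R).UpperEmbeddable) :
    (G.maxGenus : ℤ) ≥ G.betti / 2 - 1 ∧
      (Even (M.sideGraph C L).betti → Even (M.sideGraph C R).betti → G.UpperEmbeddable) := by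
  obtain ⟨k, c, hk, hβ, hβL, hβR, hle⟩ :=
    Graph.exists_genus_of_sideGraph_upperEmbeddable hV hE hG M C hLR hL hR
  have hge : k ≤ G.maxGenus := le_csSup (Graph.bddAbove_genus hV hE hG.1) hk
  have hub := Graph.maxGenus_le hV hE hG.1 (by omega)
  refine ⟨by omega, fun hLe hRe => ?_⟩
  rw [Int.even_iff] at hLe hRe
  rw [Graph.UpperEmbeddable]
  omega
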